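/- **Theorem (Soundness of front-end translations).** *States.* An IDF algebra is a set $\Sigma$ with a partial commutative, associative addition $\oplus$, maps $|\cdot|$ (core), $\mathsf{stabilize}$, $\mathsf{unit}:\Sigma\to\Sigma$ and a predicate $\mathsf{stable}$, such that, with $a\succeq b:\Leftrightarrow\exists r.\,a=b\oplus r$ (an equation between sums asserts that the sums it concludes are defined whenever those it assumes are): $c=a\oplus b\wedge c=c\oplus c\Rightarrow a=a\oplus a$; $x=x\oplus|x|$; $|x|=|x|\oplus|x|$; $x=x\oplus c\Rightarrow|x|\succeq c$; $|a\oplus b|=|a|\oplus|b|$; $a=b\oplus x\wedge a=b\oplus y\wedge|x|=|y|\Rightarrow x=y$; $\mathsf{stable}(x)\Rightarrow x=\mathsf{stabilize}(x)$; $\mathsf{stable}(\mathsf{stabilize}(x))$; $\mathsf{stabilize}(a\oplus b)=\mathsf{stabilize}(a)\oplus\mathsf{stabilize}(b)$; $x=\mathsf{stabilize}(x)\oplus|x|$; $a=b\oplus\mathsf{unit}(c)\Rightarrow a=b$; $a=a\oplus\mathsf{unit}(a)$; $|\mathsf{unit}(a)|=\mathsf{unit}(a)$; $\mathsf{stable}(\mathsf{unit}(a))$.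 Both the front-end and the intermediate verification language (IVL) have types, values, heap contexts and, for each heap context, an IDF algebra of heaps (well typed in it). The front-end types its values by a function $\mathrm{tp}$, the IVL by a relation "$v$ has type $\tau$". A type context $\Delta$ is a partial typing of the variables $\mathsf{Var}$ (common to both languages) together with a heap context. A state of $\Delta$ is a pair of a store, i.e. a partial map from $\mathsf{Var}$ to values with the same domain as $\Delta$ and values of the types given by $\Delta$, and a heap of the heap context; $\oplus$ is defined only on equal stores and adds the heaps, the other operations act on heaps only. All states are well typed in this sense. *Assertions.* For sets $P,Q$ of states (semantic assertions): $P*Q=\{\omega_1\oplus\omega_2\mid\omega_1\in P,\omega_2\in Q\}$; $P$ is self-framing, $\mathrm{sf}(P)$, iff $\omega\in P\Leftrightarrow\mathsf{stabilize}(\omega)\in P$ for all $\omega$; $B$ frames $P$ iff $\mathrm{sf}(\{\omega\}*P)$ for each stable $\omega\in B$; $P$ is monotone iff it is closed under going to $\succeq$-larger states; $P^{\uparrow}=\{\omega\mid\exists\omega_0\in P.\,\omega\succeq\omega_0\}$. A boolean expression is a partial function $e$ from states to $\{\text{true},\text{false}\}$; as a set of states, $e$ is $\{\omega\mid e(\omega)=\text{true}\}$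 and $\neg e$ is $\{\omega\mid e(\omega)=\text{false}\}$. $P$ frames $e$ iff $e$ is defined on $P$; $e$ is stable under $P$ iff $e(\omega)=e(\mathsf{stabilize}(\omega))$ for all $\omega\in P$ (including definedness); $e$ is pure iff $e(\omega)=e(|\omega|)$ for all $\omega$; $e$ is monotone iff $e(\omega)=b$ and $\omega'\succeq\omega$ imply $e(\omega')=b$. $P$ is independent of $x$ iff $\omega\in P\Leftrightarrow\omega[v/x]\in P$ for all $\omega$ and all $v$ of the type of $x$ in $\Delta$. *IVL.* Statements are $\mathsf{skip}$, arbitrary further statements with arbitrary axiomatic rules, $\mathsf{havoc}\,x$, $\mathsf{inhale}\,A$, $\mathsf{exhale}\,A$, $C_1;C_2$, $\mathsf{if}(b)\{C_1\}\,\mathsf{else}\,\{C_2\}$, where an assertion $A$ denotes a set of states for each type context. Besides the rules for the further statements, $\Delta\vdash[P]\,C\,[Q]$ is generated by $[P]\,\mathsf{skip}\,[P]$ if $\mathrm{sf}(P)$; $[P]\,\mathsf{inhale}\,A\,[P*A]$ if $\mathrm{sf}(P)$ and $P$ frames $A$; $[P]\,\mathsf{exhale}\,A\,[Q]$ if $\mathrm{sf}(P)$,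 $\mathrm{sf}(Q)$ and $P\subseteq Q*A$; $[P]\,\mathsf{havoc}\,x\,[\{\omega\mid\exists v\text{ of type }\Delta(x).\ \omega[v/x]\in P\}]$ if $\mathrm{sf}(P)$ and $\Delta(x)$ is defined; $[P]\,C_1;C_2\,[Q]$ if $[P]\,C_1\,[R]$ and $[R]\,C_2\,[Q]$; $[P]\,\mathsf{if}(b)\{C_1\}\,\mathsf{else}\,\{C_2\}\,[B_1\cup B_2]$ if $\mathrm{sf}(P)$, $P$ frames $b$, $[P*b]\,C_1\,[B_1]$ and $[P*\neg b]\,C_2\,[B_2]$. *Front-end.* Parameters are boolean expressions $b$ with a partial interpretation and a finite variable set $\mathrm{fv}(b)$; input assertions $A_p$ with an interpretation $[\![A_p]\!]_\Delta$ and a finite set $\mathrm{fv}(A_p)$; primitive statements $c_p$ with a well-formedness predicate, finite sets $\mathrm{fv}(c_p),\mathrm{wr}(c_p)$ and arbitrary CSL rules. Assertions are $A::=A_p\mid b\mid A*A\mid A\vee A\mid b\Rightarrow A\mid\exists x{:}t.\,A$ with $[\![b\Rightarrow A]\!]_\Delta$ the set of states where $b$ is defined and, if $b$ is true, $[\![A]\!]_\Delta$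 holds, $[\![\exists x{:}t.A]\!]_\Delta=\{\omega\mid\exists v.\ \mathrm{tp}(v)=t\wedge\omega[v/x]\in[\![A]\!]_{\Delta[x\mapsto t]}\}$, and the obvious clauses otherwise; $\mathrm{fv}$ is extended as usual. Statements are $c::=\mathsf{skip}\mid c_p\mid c;c\mid\mathsf{if}(b)\{c\}\,\mathsf{else}\,\{c\}\mid\mathsf{while}(b)\,I\,\{c\}\mid\{P_1\}c_1\{Q_1\}\parallel\{P_2\}c_2\{Q_2\}$; $\mathrm{wr}(c)$ and $\mathrm{fv}(c)$ are the unions over the subexpressions and substatements (annotations not counted). $c$ is well formed in $\Delta$ iff its primitive statements are, each loop has $\mathrm{sf}([\![I]\!]_\Delta)$ and $b$ stable under $[\![I]\!]_\Delta$, and each parallel composition has self-framing $[\![P_i]\!]_\Delta,[\![Q_i]\!]_\Delta$ and $\mathrm{wr}(c_i)\cap(\mathrm{fv}(c_j)\cup\mathrm{fv}(P_j)\cup\mathrm{fv}(Q_j))=\emptyset$ for $\{i,j\}=\{1,2\}$. The logic $\Delta\vdash\{P\}\,c\,\{Q\}$ (CSL) is generated by: $\{P\}\,\mathsf{skip}\,\{P\}$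 if $\mathrm{sf}(P)$; $\{P\}\,c_p\,\{Q\}$ if $\mathrm{sf}(P)$, $\mathrm{sf}(Q)$ and this is a given rule for $c_p$; sequencing; $\{A\}\,\mathsf{if}(b)\{c_1\}\,\mathsf{else}\,\{c_2\}\,\{B_1\cup B_2\}$ from $\{A\cap b\}c_1\{B_1\}$ and $\{A\cap\neg b\}c_2\{B_2\}$ if $A$ frames $b$; $\{P\}\,\mathsf{while}(b)\,I\,\{c\}\,\{P\cap\neg b\}$ from $\{P\cap b\}c\{P\}$ if $P$ frames $b$ and $b$ is stable under $P$; $\{P_1*P_2\}\,\{A_1\}c_1\{B_1\}\parallel\{A_2\}c_2\{B_2\}\,\{Q_1*Q_2\}$ from $\{P_i\}c_i\{Q_i\}$ $(i=1,2)$ if $\mathrm{fv}(c_1)\cap\mathrm{wr}(c_2)=\mathrm{fv}(c_2)\cap\mathrm{wr}(c_1)=\emptyset$, $P_2,Q_2$ are independent of each $x\in\mathrm{wr}(c_1)$ and $P_1,Q_1$ of each $x\in\mathrm{wr}(c_2)$; $\{P*R\}c\{Q*R\}$ from $\{P\}c\{Q\}$ if $\mathrm{sf}(R)$ and $R$ is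 independent of each $x\in\mathrm{wr}(c)$; $\{P'\}c\{Q'\}$ from $\{P\}c\{Q\}$ if $P'\subseteq P$, $Q\subseteq Q'$, $\mathrm{sf}(P')$, $\mathrm{sf}(Q')$. *Translation.* Parameters are maps of types $\mathrm{tr}_t$, values $\mathrm{tr}_v$, heap contexts, heaps $\mathrm{tr}_h$ (respecting heap contexts), boolean expressions $\mathrm{tr}_b$, input assertions and primitive statements, and for each type $t$ either no invariant or an IVL boolean expression $\mathrm{inv}(t,x)$ for every variable $x$. Type contexts and states are translated componentwise; write $\mathrm{tr}(\Delta)$, $\mathrm{tr}(\omega)$. For a set $A$ of IVL states, $\mathrm{btr}(A)=\{\omega\mid\mathrm{tr}(\omega)\in A\}$. The translation $\mathrm{tr}$ of assertions commutes with the connectives, and $\mathrm{tr}(\exists x{:}t.A)=\exists x{:}\mathrm{tr}_t(t).\ \mathrm{inv}(t,x)*\mathrm{tr}(A)$ (without the conjunct $\mathrm{inv}(t,x)$ if $t$ has no invariant). A statement $c$ is translated to a pair of a main statement $\mathrm{m}(c)$ and a finite set $\mathrm{e}(c)$ of auxiliary statements: $\mathrm m$ commutes with $\mathsf{skip}$,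 $;$ and $\mathsf{if}$ and is given on primitive statements; with $J=\mathrm{tr}(I)*(\mathrm{tr}_b(b)\vee\neg\mathrm{tr}_b(b))$, $$\mathrm m(\mathsf{while}(b)\,I\,\{c\})=\mathsf{exhale}\,J;\ \mathsf{havoc}\,\mathrm{wr}(c);\ \mathsf{inhale}\,\mathrm{tr}(I)*\neg\mathrm{tr}_b(b),$$ $$\mathrm m(\{P_1\}c_1\{Q_1\}\parallel\{P_2\}c_2\{Q_2\})=\mathsf{exhale}\,\mathrm{tr}(P_1*P_2);\ \mathsf{havoc}\,\mathrm{wr}(c_1)\cup\mathrm{wr}(c_2);\ \mathsf{inhale}\,\mathrm{tr}(Q_1*Q_2);$$ and $\mathrm e(c)$ consists of $\mathsf{inhale}\,\mathrm{tr}(I)*\mathrm{tr}_b(b);\ \mathrm m(c');\ \mathsf{exhale}\,J$ for each loop $\mathsf{while}(b)\,I\,\{c'\}$ in $c$ and of $\mathsf{inhale}\,\mathrm{tr}(P_i);\ \mathrm m(c_i);\ \mathsf{exhale}\,\mathrm{tr}(Q_i)$ $(i=1,2)$ for each parallel composition in $c$. *Requirements*, for all type contexts $\Delta$ of the front-end: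 1. (Front-end) Boolean expressions are pure; changing variables outside $\mathrm{fv}(b)$, resp. $\mathrm{fv}(A_p)$, to values of their types changes neither $b$ nor membership in $[\![A_p]\!]_\Delta$; $\mathrm{wr}(c_p)\subseteq\mathrm{dom}(\Delta)$ for each $c_p$ that is well formed in $\Delta$; $\Delta\vdash\{P\}c_p\{Q\}$ implies $\Delta\vdash\{P^\uparrow\}c_p\{Q^\uparrow\}$. 2. (Types and values) $\mathrm{tr}_v(a)$ has type $\mathrm{tr}_t(\mathrm{tp}(a))$; $\mathrm{tr}_v$ is injective; if $t$ has no invariant, every value of type $\mathrm{tr}_t(t)$ is $\mathrm{tr}_v(a)$ for some $a$ of type $t$; otherwise $\mathrm{inv}(t,x)$ is pure, monotone, and in IVL states that map $x$ to a value $v$ of type $\mathrm{tr}_t(t)$ it is true iff $v=\mathrm{tr}_v(a)$ for some $a$ of type $t$. 3. (Heaps: homomorphism, subtraction, stability) If $\varphi_1\oplus\varphi_2$ is defined then $\mathrm{tr}_h(\varphi_1)\oplus\mathrm{tr}_h(\varphi_2)=\mathrm{tr}_h(\varphi_1\oplus\varphi_2)$; if $\mathrm{tr}_h(\varphi)=\Phi_1\oplus\mathrm{tr}_h(\varphi_2)$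 then there is $\varphi_1$ with $\mathrm{tr}_h(\varphi_1)\succeq\Phi_1$ and $\varphi=\varphi_1\oplus\varphi_2$; $\mathsf{stabilize}(\mathrm{tr}_h(\varphi))=\mathrm{tr}_h(\mathsf{stabilize}(\varphi))$. 4. (Translation) $b(\omega)=\mathrm{tr}_b(b)(\mathrm{tr}(\omega))$ (including definedness), and $\mathrm{tr}_b(b)$ is monotone; for each input assertion $A$: $\omega\in[\![A]\!]_\Delta$ iff $\mathrm{tr}(\omega)\in\mathrm{tr}(A)$, $\mathrm{tr}(A)$ is monotone, and $A$ is backward satisfiable, i.e. for each IVL state $\Omega\in\mathrm{tr}(A)$ with $\mathrm{tr}(\omega_b)\succeq\Omega$ for some front-end state $\omega_b$ there is $\omega\in[\![A]\!]_\Delta$ with $\Omega\succeq\mathrm{tr}(\omega)$; for each primitive statement $c_p$ that is well formed in $\Delta$: if $P,Q$ are monotone and $\mathrm{tr}(\Delta)\vdash[P]\,\mathrm m(c_p)\,[Q]$ then $\Delta\vdash\{\mathrm{btr}(P)\}\,c_p\,\{\mathrm{btr}(Q)\}$, and (affinity of the IVL) for all $P,Q$, $\mathrm{tr}(\Delta)\vdash[P]\,\mathrm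 m(c_p)\,[Q]$ implies $\mathrm{tr}(\Delta)\vdash[P^\uparrow]\,\mathrm m(c_p)\,[Q^\uparrow]$. *Claim.* Assume these requirements. Let $c$ be a front-end statement that is well formed in $\Delta_F$, let $(C_m,C_e)$ be its translation, and let $P,Q$ be front-end assertions. If $\mathrm{tr}(\Delta_F)\vdash[\mathrm{tr}(P)]\,C_m\,[\mathrm{tr}(Q)]$, and for every $C\in C_e$ there is a set $Q_C$ of IVL states with $\mathrm{tr}(\Delta_F)\vdash[\top]\,C\,[Q_C]$, where $\top$ is the set of all states, then $\Delta_F\vdash\{[\![P]\!]\}\,c\,\{[\![Q]\!]\}$. -/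

import Mathlib

universe u v w

namespace TransVerif

/-! ### IDF algebras and semantic assertions -/

/-- An IDF algebra: a set with a partial commutative and associative addition (`op a b = none` means
that the sum of `a` and `b` is undefined) with a duplicable core, a notion of stability and local units. -/
class IDFAlgebra (S : Type u) where
  op : S → S → Option S
  core : S → S
  stable : S → Prop
  stabilize : S → S
  unit : S → S
  op_comm : ∀ a b, op a b = op b a
  op_assoc : ∀ a b c, (op b c).bind (fun bc => op a bc) = (op a b).bind (fun ab => op ab c)
  positivity : ∀ a b c, op a b = some c → op c c = some c → op a a = some a
  op_core : ∀ x, op x (core x) = some x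
  core_idem : ∀ x, op (core x) (core x) = some (core x)
  core_max : ∀ x c, op x c = some x → ∃ r, op c r = some (core x)
  core_op : ∀ a b c, op a b = some c → op (core a) (core b) = some (core c)
  cancel : ∀ a b x y, op b x = some a → op b y = some a → core x = core y → x = y
  stabilize_of_stable : ∀ x, stable x → x = stabilize x
  stable_stabilize : ∀ x, stable (stabilize x)
  stabilize_op : ∀ a b c, op a b = some c → op (stabilize a) (stabilize b) = some (stabilize c)
  op_stabilize_core : ∀ x, op (stabilize x) (core x) = some x
  eq_of_op_unit : ∀ a b c, op b (unit c) = some a → a = b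
  op_unit : ∀ a, op a (unit a) = some a
  core_unit : ∀ a, core (unit a) = unit a
  stable_unit : ∀ a, stable (unit a)

section Semantic

variable {S : Type u} [IDFAlgebra S]

/-- `Geq a b` is `a ⪰ b`. -/
def Geq (a b : S) : Prop := ∃ r, IDFAlgebra.op b r = some a

/-- Separating conjunction of semantic assertions. -/
def sepConj (P Q : Set S) : Set S :=
  {ω | ∃ ω₁ ∈ P, ∃ ω₂ ∈ Q, IDFAlgebra.op ω₁ ω₂ = some ω}

def SelfFraming (P : Set S) : Prop := ∀ ω, ω ∈ P ↔ IDFAlgebra.stabilize ω ∈ P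

/-- The state `ω` frames the assertion `P`. -/
def StateFrames (ω : S) (P : Set S) : Prop := SelfFraming (sepConj {ω} P)

/-- The assertion `B` frames the assertion `P`. -/
def Frames (B P : Set S) : Prop := ∀ ω ∈ B, IDFAlgebra.stable ω → StateFrames ω P

/-- The assertion `P` frames the partial boolean expression `e`. -/
def FramesExpr (P : Set S) (e : S → Option Bool) : Prop := ∀ ω ∈ P, (e ω).isSome

/-- The partial boolean expression `e` is stable under `P`. -/
def StableUnder (e : S → Option Bool) (P : Set S) : Prop :=
  ∀ ω ∈ P, e ω = e (IDFAlgebra.stabilize ω)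

def Monotone (P : Set S) : Prop := ∀ ω ∈ P, ∀ ω', Geq ω' ω → ω' ∈ P

/-- The least monotone assertion that contains `P`. -/
def monotonize (P : Set S) : Set S := {ω | ∃ ω₀ ∈ P, Geq ω ω₀}

/-- A pure expression only depends on the core of the state. -/
def PureExpr (e : S → Option Bool) : Prop := ∀ ω, e ω = e (IDFAlgebra.core ω)

/-- Growing the state preserves definedness and value of the expression. -/
def MonotoneExpr (e : S → Option Bool) : Prop :=
  ∀ ω ω' b, e ω = some b → Geq ω' ω → e ω' = some b

/-- The states in which the expression `e` is defined and has the value `b`. -/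
def exprSet (e : S → Option Bool) (b : Bool) : Set S := {ω | e ω = some b}

end Semantic

/-! ### Typed states -/

/-- The ingredients of the states of a language: types, values, and heaps. A type context
consists of a typing of the local variables and of a context `κ : HeapCtx` for the heap
(for instance, a typing of the fields); `Heap κ` is the IDF algebra of the heaps that are
well typed in `κ`. -/
structure StateModel where
  Ty : Type u
  Val : Type u
  HasTy : Val → Ty → Prop
  HeapCtx : Type u
  Heap : HeapCtx → Type u
  idf : ∀ κ, IDFAlgebra (Heap κ)

instance (M : StateModel.{u}) (κ : M.HeapCtx) : IDFAlgebra (M.Heap κ) := M.idf κ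

/-- Type contexts. -/
@[ext] structure Ctx (Var : Type w) (M : StateModel.{u}) where
  vars : Var → Option M.Ty
  heap : M.HeapCtx

/-- The states that are well typed in the type context `Δ`: a store of local variables, whose
domain is that of `Δ` and whose values have the types given by `Δ`, and a well-typed heap. -/
@[ext] structure State {Var : Type w} {M : StateModel.{u}} (Δ : Ctx Var M) where
  store : Var → Option M.Val
  heap : M.Heap Δ.heap
  typed : ∀ x, Option.Rel M.HasTy (store x) (Δ.vars x)

namespace State

variable {Var : Type w} {M : StateModel.{u}} {Δ : Ctx Var M}

open Classical in
/-- Addition of states: stores form an agreement algebra, heaps are added. -/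
noncomputable def op (ω₁ ω₂ : State Δ) : Option (State Δ) :=
  if ω₁.store = ω₂.store then
    (IDFAlgebra.op ω₁.heap ω₂.heap).map (fun h => { ω₁ with heap := h })
  else none

theorem op_eq_some {a b c : State Δ} :
    op a b = some c ↔ a.store = c.store ∧ b.store = c.store ∧
      IDFAlgebra.op a.heap b.heap = some c.heap := by
  unfold op
  constructor
  · intro h
    split_ifs at h with hs
    obtain ⟨k, hk, rfl⟩ := Option.map_eq_some_iff.1 h
    exact ⟨rfl, hs.symm, hk⟩
  · rintro ⟨h1, h2, h3⟩
    rw [if_pos (h1.trans h2.symm), h3]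
    simp only [Option.map_some, Option.some.injEq]
    ext1
    · exact h1
    · rfl

/-- The state model is the product of the agreement algebra of stores, on which the core,
stabilization and unit maps are the identity and every store is stable, and the heap algebra. -/
noncomputable instance : IDFAlgebra (State Δ) where
  op := op
  core ω := { ω with heap := IDFAlgebra.core ω.heap }
  stable ω := IDFAlgebra.stable ω.heap
  stabilize ω := { ω with heap := IDFAlgebra.stabilize ω.heap }
  unit ω := { ω with heap := IDFAlgebra.unit ω.heap }
  op_comm a b := by
    apply Option.ext
    intro c
    rw [op_eq_some, op_eq_some, IDFAlgebra.op_comm]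
    tauto
  op_assoc a b c := by
    apply Option.ext
    intro d
    have key := IDFAlgebra.op_assoc a.heap b.heap c.heap
    simp only [Option.bind_eq_some_iff, op_eq_some]
    constructor
    · rintro ⟨bc, ⟨h1, h2, h3⟩, h4, h5, h6⟩
      have h : ((IDFAlgebra.op a.heap b.heap).bind fun ab => IDFAlgebra.op ab c.heap)
          = some d.heap := by
        rw [← key, h3]; exact h6
      obtain ⟨ab, hab, habc⟩ := Option.bind_eq_some_iff.1 h
      exact ⟨{ d with heap := ab }, ⟨h4, h1.trans h5, hab⟩, rfl, h2.trans h5, habc⟩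
    · rintro ⟨ab, ⟨h1, h2, h3⟩, h4, h5, h6⟩
      have h : ((IDFAlgebra.op b.heap c.heap).bind fun bc => IDFAlgebra.op a.heap bc)
          = some d.heap := by
        rw [key, h3]; exact h6
      obtain ⟨bc, hbc, habc⟩ := Option.bind_eq_some_iff.1 h
      exact ⟨{ d with heap := bc }, ⟨h2.trans h4, h5, hbc⟩, h1.trans h4, rfl, habc⟩
  positivity a b c := by
    simp only [op_eq_some]
    rintro ⟨_, _, h3⟩ ⟨_, _, h6⟩
    exact ⟨trivial, trivial, IDFAlgebra.positivity _ _ _ h3 h6⟩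
  op_core x := op_eq_some.2 ⟨rfl, rfl, IDFAlgebra.op_core _⟩
  core_idem x := op_eq_some.2 ⟨rfl, rfl, IDFAlgebra.core_idem _⟩
  core_max x c := by
    simp only [op_eq_some]
    rintro ⟨_, h2, h3⟩
    obtain ⟨r, hr⟩ := IDFAlgebra.core_max _ _ h3
    exact ⟨{ x with heap := r }, h2, rfl, hr⟩
  core_op a b c := by
    simp only [op_eq_some]
    rintro ⟨h1, h2, h3⟩
    exact ⟨h1, h2, IDFAlgebra.core_op _ _ _ h3⟩
  cancel a b x y := by
    simp only [op_eq_some]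
    rintro ⟨_, h2, h3⟩ ⟨_, h5, h6⟩ h
    have hc : IDFAlgebra.core x.heap = IDFAlgebra.core y.heap := congrArg State.heap h
    ext1
    · exact h2.trans h5.symm
    · exact IDFAlgebra.cancel _ _ _ _ h3 h6 hc
  stabilize_of_stable x h := by
    ext1
    · rfl
    · exact IDFAlgebra.stabilize_of_stable _ h
  stable_stabilize x := IDFAlgebra.stable_stabilize x.heap
  stabilize_op a b c := by
    simp only [op_eq_some]
    rintro ⟨h1, h2, h3⟩
    exact ⟨h1, h2, IDFAlgebra.stabilize_op _ _ _ h3⟩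
  op_stabilize_core x := op_eq_some.2 ⟨rfl, rfl, IDFAlgebra.op_stabilize_core _⟩
  eq_of_op_unit a b c := by
    simp only [op_eq_some]
    rintro ⟨h1, _, h3⟩
    ext1
    · exact h1.symm
    · exact IDFAlgebra.eq_of_op_unit _ _ _ h3
  op_unit a := op_eq_some.2 ⟨rfl, rfl, IDFAlgebra.op_unit _⟩
  core_unit a := by
    ext1
    · rfl
    · exact IDFAlgebra.core_unit _
  stable_unit a := IDFAlgebra.stable_unit a.heap

end State

section Update

variable {Var : Type w} [DecidableEq Var] {M : StateModel.{u}}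

/-- In the context `Δ`, `v` is a well-typed value for the declared variable `x`. -/
def Ctx.Admits (Δ : Ctx Var M) (x : Var) (v : M.Val) : Prop :=
  ∃ t, Δ.vars x = some t ∧ M.HasTy v t

/-- `Δ[x ↦ t]`. -/
def Ctx.extend (Δ : Ctx Var M) (x : Var) (t : M.Ty) : Ctx Var M where
  vars := Function.update Δ.vars x (some t)
  heap := Δ.heap

/-- `ω[v/x]`, for a declared variable `x` and a value `v` of its type. -/
def State.set {Δ : Ctx Var M} (ω : State Δ) (x : Var) (v : M.Val) (h : Δ.Admits x v) :
    State Δ where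
  store := Function.update ω.store x (some v)
  heap := ω.heap
  typed y := by
    by_cases hy : y = x
    · subst hy
      obtain ⟨t, ht, hv⟩ := h
      rw [Function.update_self, ht]
      exact Option.Rel.some hv
    · rw [Function.update_of_ne hy]
      exact ω.typed y

/-- `ω[v/x]` for a quantified variable `x` of type `t`, a state of the context `Δ[x ↦ t]`. -/
def State.bindVar {Δ : Ctx Var M} (ω : State Δ) (x : Var) {t : M.Ty} (v : M.Val)
    (h : M.HasTy v t) : State (Δ.extend x t) where
  store := Function.update ω.store x (some v)
  heap := ω.heap
  typed y := by
    by_cases hy : y = x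
    · subst hy
      simp only [Ctx.extend, Function.update_self]
      exact Option.Rel.some h
    · simp only [Ctx.extend, Function.update_of_ne hy]
      exact ω.typed y

/-- `P` is independent of the local variable `x`. -/
def IndependentOf {Δ : Ctx Var M} (P : Set (State Δ)) (x : Var) : Prop :=
  ∀ (ω : State Δ) (v : M.Val) (h : Δ.Admits x v), ω ∈ P ↔ ω.set x v h ∈ P

/-- `∃ x ∈ τ. P` where `τ` is the type that the context gives to `x`. -/
def existsVar {Δ : Ctx Var M} (x : Var) (P : Set (State Δ)) : Set (State Δ) :=
  {ω | ∃ (v : M.Val) (h : Δ.Admits x v), ω.set x v h ∈ P}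

end Update

/-! ### The intermediate verification language -/

/-- An intermediate verification language. Besides the control structures and the statements
`havoc`, `inhale`, `exhale` it may have arbitrary other statements `Prim`, with arbitrary axiomatic
rules `primAx`. -/
structure IVL (Var : Type w) where
  model : StateModel.{u}
  Prim : Type u
  primAx : (Δ : Ctx Var model) → Set (State Δ) → Prim → Set (State Δ) → Prop

namespace IVL

variable {Var : Type w}

/-- Boolean expressions, given by their partial evaluation functions. -/
abbrev Expr (L : IVL.{u} Var) := (Δ : Ctx Var L.model) → State Δ → Option Bool

/-- Assertions, given by the sets of well-typed states that satisfy them. -/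
abbrev Assertion (L : IVL.{u} Var) := (Δ : Ctx Var L.model) → Set (State Δ)

variable {L : IVL.{u} Var}

def Expr.not (e : L.Expr) : L.Expr := fun Δ Ω => (e Δ Ω).map (fun b => !b)

def Expr.or (e₁ e₂ : L.Expr) : L.Expr :=
  fun Δ Ω => (e₁ Δ Ω).bind (fun a => (e₂ Δ Ω).map (fun b => a || b))

/-- A boolean expression used as an assertion. -/
def Assertion.ofExpr (e : L.Expr) : L.Assertion := fun Δ => exprSet (e Δ) true

def Assertion.star (A B : L.Assertion) : L.Assertion := fun Δ => sepConj (A Δ) (B Δ)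

def Assertion.or (A B : L.Assertion) : L.Assertion := fun Δ => A Δ ∪ B Δ

/-- `e ⇒ A` -/
def Assertion.imp (e : L.Expr) (A : L.Assertion) : L.Assertion :=
  fun Δ => {Ω | ∃ b, e Δ Ω = some b ∧ (b = true → Ω ∈ A Δ)}

/-- `∃ x : τ. A` -/
def Assertion.ex [DecidableEq Var] (x : Var) (τ : L.model.Ty) (A : L.Assertion) : L.Assertion :=
  fun Δ => {Ω | ∃ (v : L.model.Val) (h : L.model.HasTy v τ),
    Ω.bindVar x v h ∈ A (Δ.extend x τ)}

inductive Stmt (L : IVL.{u} Var) where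
  | skip : Stmt L
  | prim (p : L.Prim) : Stmt L
  | havoc (x : Var) : Stmt L
  | inhale (A : L.Assertion) : Stmt L
  | exhale (A : L.Assertion) : Stmt L
  | seq (C₁ C₂ : Stmt L) : Stmt L
  | ite (b : L.Expr) (C₁ C₂ : Stmt L) : Stmt L

/-- `havoc x₁; …; havoc xₙ` -/
def Stmt.havocList : List Var → Stmt L
  | [] => .skip
  | [x] => .havoc x
  | x :: y :: l => .seq (.havoc x) (Stmt.havocList (y :: l))

/-- `havoc V` for a finite set `V` of variables. -/
noncomputable def Stmt.havocs (V : Finset Var) : L.Stmt := Stmt.havocList V.toList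

/-- The axiomatic semantics `Δ ⊢ [P] C [Q]` of the intermediate verification language. -/
inductive AxSem [DecidableEq Var] (L : IVL.{u} Var) (Δ : Ctx Var L.model) :
    Set (State Δ) → L.Stmt → Set (State Δ) → Prop
  | skip {P} : SelfFraming P → AxSem L Δ P .skip P
  | prim {P p Q} : L.primAx Δ P p Q → AxSem L Δ P (.prim p) Q
  | inhale {P A} : SelfFraming P → Frames P (A Δ) →
      AxSem L Δ P (.inhale A) (sepConj P (A Δ))
  | exhale {P A Q} : SelfFraming P → P ⊆ sepConj Q (A Δ) → SelfFraming Q →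
      AxSem L Δ P (.exhale A) Q
  | havoc {P x τ} : SelfFraming P → Δ.vars x = some τ →
      AxSem L Δ P (.havoc x) (existsVar x P)
  | seq {P R Q C₁ C₂} : AxSem L Δ P C₁ R → AxSem L Δ R C₂ Q → AxSem L Δ P (.seq C₁ C₂) Q
  | ite {P b C₁ C₂ B₁ B₂} : SelfFraming P → FramesExpr P (b Δ) →
      AxSem L Δ (sepConj P (exprSet (b Δ) true)) C₁ B₁ →
      AxSem L Δ (sepConj P (exprSet (b Δ) false)) C₂ B₂ →
      AxSem L Δ P (.ite b C₁ C₂) (B₁ ∪ B₂)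

end IVL

/-! ### The front-end language -/

/-- Types, values and ghost heaps of a front-end language. -/
structure FrontEndStates where
  Ty : Type u
  Val : Type u
  /-- the type of a value -/
  tp : Val → Ty
  HeapCtx : Type u
  /-- the ghost heaps that are well typed in a heap context -/
  Heap : HeapCtx → Type u
  idf : ∀ κ, IDFAlgebra (Heap κ)

/-- The state model of the front-end: a value `a` has type `t` iff `tp a = t`. -/
abbrev FrontEndStates.model (F : FrontEndStates.{u}) : StateModel.{u} where
  Ty := F.Ty
  Val := F.Val
  HasTy a t := F.tp a = t
  HeapCtx := F.HeapCtx
  Heap := F.Heap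
  idf := F.idf

instance (F : FrontEndStates.{u}) (κ : F.HeapCtx) : IDFAlgebra (F.Heap κ) := F.idf κ

/-- The parameters that describe the front-end language and its logic. -/
structure FrontEnd (Var : Type w) extends FrontEndStates.{u} where
  /-- boolean expressions -/
  BE : Type u
  evalBE : BE → (Δ : Ctx Var toFrontEndStates.model) → State Δ → Option Bool
  fvBE : BE → Finset Var
  /-- input assertions -/
  InAsrt : Type u
  interpIn : InAsrt → (Δ : Ctx Var toFrontEndStates.model) → Set (State Δ)
  fvIn : InAsrt → Finset Var
  /-- primitive statements -/
  Prim : Type u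
  wfPrim : Ctx Var toFrontEndStates.model → Prim → Prop
  /-- the rules of the concurrent separation logic for primitive statements -/
  cslPrim : (Δ : Ctx Var toFrontEndStates.model) →
    Set (State Δ) → Prim → Set (State Δ) → Prop
  wrPrim : Prim → Finset Var
  fvPrim : Prim → Finset Var

namespace FrontEnd

variable {Var : Type w}

/-- Front-end assertions. -/
inductive Assertion (F : FrontEnd.{u} Var) where
  | input (A : F.InAsrt) : Assertion F
  | bool (b : F.BE) : Assertion F
  | star (A₁ A₂ : Assertion F) : Assertion F
  | or (A₁ A₂ : Assertion F) : Assertion F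
  | imp (b : F.BE) (A : Assertion F) : Assertion F
  | ex (x : Var) (t : F.Ty) (A : Assertion F) : Assertion F

/-- Front-end statements. Loops carry their invariant, parallel compositions the pre- and
postconditions of both branches: `par P₁ c₁ Q₁ P₂ c₂ Q₂` is `{P₁} c₁ {Q₁} ∥ {P₂} c₂ {Q₂}`. -/
inductive Stmt (F : FrontEnd.{u} Var) where
  | skip : Stmt F
  | prim (c : F.Prim) : Stmt F
  | seq (c₁ c₂ : Stmt F) : Stmt F
  | ite (b : F.BE) (c₁ c₂ : Stmt F) : Stmt F
  | while (b : F.BE) (I : F.Assertion) (c : Stmt F) : Stmt F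
  | par (P₁ : F.Assertion) (c₁ : Stmt F) (Q₁ : F.Assertion)
      (P₂ : F.Assertion) (c₂ : Stmt F) (Q₂ : F.Assertion) : Stmt F

variable [DecidableEq Var] {F : FrontEnd.{u} Var}

/-- The set of states of the context `Δ` that satisfy the assertion. -/
def Assertion.interp : F.Assertion → (Δ : Ctx Var F.model) → Set (State Δ)
  | .input A, Δ => F.interpIn A Δ
  | .bool b, Δ => exprSet (F.evalBE b Δ) true
  | .star A₁ A₂, Δ => sepConj (A₁.interp Δ) (A₂.interp Δ)
  | .or A₁ A₂, Δ => A₁.interp Δ ∪ A₂.interp Δ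
  | .imp b A, Δ => {ω | ∃ a, F.evalBE b Δ ω = some a ∧ (a = true → ω ∈ A.interp Δ)}
  | .ex x t A, Δ => {ω | ∃ (v : F.Val) (h : F.model.HasTy v t),
      ω.bindVar x v h ∈ A.interp (Δ.extend x t)}

def Assertion.fv : F.Assertion → Finset Var
  | .input A => F.fvIn A
  | .bool b => F.fvBE b
  | .star A₁ A₂ => A₁.fv ∪ A₂.fv
  | .or A₁ A₂ => A₁.fv ∪ A₂.fv
  | .imp b A => F.fvBE b ∪ A.fv
  | .ex x _ A => A.fv \ {x}

namespace Stmt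

/-- free variables -/
def fv : F.Stmt → Finset Var
  | .skip => ∅
  | .prim c => F.fvPrim c
  | .seq c₁ c₂ => c₁.fv ∪ c₂.fv
  | .ite b c₁ c₂ => F.fvBE b ∪ c₁.fv ∪ c₂.fv
  | .while b _ c => F.fvBE b ∪ c.fv
  | .par _ c₁ _ _ c₂ _ => c₁.fv ∪ c₂.fv

/-- modified variables -/
def wr : F.Stmt → Finset Var
  | .skip => ∅
  | .prim c => F.wrPrim c
  | .seq c₁ c₂ => c₁.wr ∪ c₂.wr
  | .ite _ c₁ c₂ => c₁.wr ∪ c₂.wr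
  | .while _ _ c => c.wr
  | .par _ c₁ _ _ c₂ _ => c₁.wr ∪ c₂.wr

/-- Well-formedness in the type context `Δ`. -/
def WF (Δ : Ctx Var F.model) : F.Stmt → Prop
  | .skip => True
  | .prim c => F.wfPrim Δ c
  | .seq c₁ c₂ => c₁.WF Δ ∧ c₂.WF Δ
  | .ite _ c₁ c₂ => c₁.WF Δ ∧ c₂.WF Δ
  | .while b I c =>
      c.WF Δ ∧ SelfFraming (I.interp Δ) ∧ StableUnder (F.evalBE b Δ) (I.interp Δ)
  | .par P₁ c₁ Q₁ P₂ c₂ Q₂ =>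
      c₁.WF Δ ∧ c₂.WF Δ ∧
      SelfFraming (P₁.interp Δ) ∧ SelfFraming (Q₁.interp Δ) ∧
      SelfFraming (P₂.interp Δ) ∧ SelfFraming (Q₂.interp Δ) ∧
      c₁.wr ∩ (c₂.fv ∪ P₂.fv ∪ Q₂.fv) = ∅ ∧
      c₂.wr ∩ (c₁.fv ∪ P₁.fv ∪ Q₁.fv) = ∅

end Stmt

/-- The concurrent separation logic of the front-end: `CSL F Δ P c Q` is `Δ ⊢ {P} c {Q}`. -/
inductive CSL (F : FrontEnd.{u} Var) (Δ : Ctx Var F.model) :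
    Set (State Δ) → F.Stmt → Set (State Δ) → Prop
  | skip {P} : SelfFraming P → CSL F Δ P .skip P
  | prim {P c Q} : SelfFraming P → SelfFraming Q → F.cslPrim Δ P c Q → CSL F Δ P (.prim c) Q
  | seq {P R Q c₁ c₂} : CSL F Δ P c₁ R → CSL F Δ R c₂ Q → CSL F Δ P (.seq c₁ c₂) Q
  | ite {A b c₁ c₂ B₁ B₂} : FramesExpr A (F.evalBE b Δ) →
      CSL F Δ (A ∩ exprSet (F.evalBE b Δ) true) c₁ B₁ →
      CSL F Δ (A ∩ exprSet (F.evalBE b Δ) false) c₂ B₂ →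
      CSL F Δ A (.ite b c₁ c₂) (B₁ ∪ B₂)
  | while {P b I c} : FramesExpr P (F.evalBE b Δ) → StableUnder (F.evalBE b Δ) P →
      CSL F Δ (P ∩ exprSet (F.evalBE b Δ) true) c P →
      CSL F Δ P (.while b I c) (P ∩ exprSet (F.evalBE b Δ) false)
  | par {P₁ P₂ Q₁ Q₂ : Set (State Δ)} {c₁ c₂ A₁ B₁ A₂ B₂} :
      CSL F Δ P₁ c₁ Q₁ → CSL F Δ P₂ c₂ Q₂ →
      c₁.fv ∩ c₂.wr = ∅ → c₂.fv ∩ c₁.wr = ∅ →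
      (∀ x ∈ c₁.wr, IndependentOf P₂ x ∧ IndependentOf Q₂ x) →
      (∀ x ∈ c₂.wr, IndependentOf P₁ x ∧ IndependentOf Q₁ x) →
      CSL F Δ (sepConj P₁ P₂) (.par A₁ c₁ B₁ A₂ c₂ B₂) (sepConj Q₁ Q₂)
  | frame {P c Q} {R : Set (State Δ)} : CSL F Δ P c Q → SelfFraming R →
      (∀ x ∈ c.wr, IndependentOf R x) → CSL F Δ (sepConj P R) c (sepConj Q R)
  | conseq {P c Q P' Q'} : CSL F Δ P c Q → P' ⊆ P → Q ⊆ Q' →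
      SelfFraming P' → SelfFraming Q' → CSL F Δ P' c Q'

/-- The requirements on the front-end language and its logic. -/
structure Requirements (F : FrontEnd.{u} Var) : Prop where
  pure_be : ∀ b Δ, PureExpr (F.evalBE b Δ)
  fv_be : ∀ b Δ, ∀ x ∉ F.fvBE b, ∀ (ω : State Δ) (v : F.Val) (h : Ctx.Admits Δ x v),
    F.evalBE b Δ ω = F.evalBE b Δ (ω.set x v h)
  fv_in : ∀ A Δ, ∀ x ∉ F.fvIn A, IndependentOf (F.interpIn A Δ) x
  wr_declared : ∀ Δ c, F.wfPrim Δ c → ∀ x ∈ F.wrPrim c, (Δ.vars x).isSome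
  affine : ∀ Δ P c Q, CSL F Δ P (.prim c) Q →
    CSL F Δ (monotonize P) (.prim c) (monotonize Q)

end FrontEnd

/-! ### The front-end translation -/

/-- The parameters that describe the translation of a front-end into an intermediate verification
language. The fields `val_typed` and `heap` express that the encoding of states preserves
well-typedness. -/
structure Translation {Var : Type w} (F : FrontEnd.{u} Var) (L : IVL.{v} Var) where
  ty : F.Ty → L.model.Ty
  val : F.Val → L.model.Val
  val_typed : ∀ a, L.model.HasTy (val a) (ty (F.tp a))
  heapCtx : F.HeapCtx → L.model.HeapCtx
  heap : ∀ κ, F.model.Heap κ → L.model.Heap (heapCtx κ)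
  be : F.BE → L.Expr
  input : F.InAsrt → L.Assertion
  prim : F.Prim → L.Stmt
  /-- `haveInv t = some e`: the expression `e x` says that the value of `x` encodes a front-end
  value of type `t`; `haveInv t = none`: no such expression is needed for the type `t`. -/
  haveInv : F.Ty → Option (Var → L.Expr)

namespace Translation

variable {Var : Type w} {F : FrontEnd.{u} Var} {L : IVL.{v} Var} (T : Translation F L)

/-- The translation of type contexts. -/
def ctx (Δ : Ctx Var F.model) : Ctx Var L.model where
  vars x := (Δ.vars x).map T.ty
  heap := T.heapCtx Δ.heap

/-- The encoding of front-end states. -/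
def state {Δ : Ctx Var F.model} (ω : State Δ) : State (T.ctx Δ) where
  store x := (ω.store x).map T.val
  heap := T.heap Δ.heap ω.heap
  typed x := by
    have h := ω.typed x
    simp only [ctx]
    generalize ω.store x = s at h ⊢
    generalize Δ.vars x = t at h ⊢
    cases h with
    | none => exact Option.Rel.none
    | some hv =>
      cases hv
      exact Option.Rel.some (T.val_typed _)

/-- Backward translation of semantic assertions. -/
def btr {Δ : Ctx Var F.model} (A : Set (State (T.ctx Δ))) : Set (State Δ) :=
  {ω | T.state ω ∈ A}

variable [DecidableEq Var]

/-- The translation of assertions. -/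
def asrt : F.Assertion → L.Assertion
  | .input A => T.input A
  | .bool b => .ofExpr (T.be b)
  | .star A₁ A₂ => .star (asrt A₁) (asrt A₂)
  | .or A₁ A₂ => .or (asrt A₁) (asrt A₂)
  | .imp b A => .imp (T.be b) (asrt A)
  | .ex x t A => .ex x (T.ty t)
      (match T.haveInv t with
        | none => asrt A
        | some e => .star (.ofExpr (e x)) (asrt A))

/-- `tr(I) * (tr(b) ∨ ¬ tr(b))` -/
def loopInv (b : F.BE) (I : F.Assertion) : L.Assertion :=
  .star (T.asrt I) (.ofExpr (.or (T.be b) (.not (T.be b))))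

/-- The main statement of the translation. -/
noncomputable def main : F.Stmt → L.Stmt
  | .skip => .skip
  | .prim c => T.prim c
  | .seq c₁ c₂ => .seq (main c₁) (main c₂)
  | .ite b c₁ c₂ => .ite (T.be b) (main c₁) (main c₂)
  | .while b I c =>
      .seq (.exhale (T.loopInv b I))
        (.seq (.havocs c.wr)
          (.inhale (.star (T.asrt I) (.ofExpr (.not (T.be b))))))
  | .par P₁ c₁ Q₁ P₂ c₂ Q₂ =>
      .seq (.exhale (T.asrt (.star P₁ P₂)))
        (.seq (.havocs (c₁.wr ∪ c₂.wr)) (.inhale (T.asrt (.star Q₁ Q₂))))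

/-- The auxiliary statements of the translation. -/
noncomputable def aux : F.Stmt → Set L.Stmt
  | .skip => ∅
  | .prim _ => ∅
  | .seq c₁ c₂ => aux c₁ ∪ aux c₂
  | .ite _ c₁ c₂ => aux c₁ ∪ aux c₂
  | .while b I c =>
      {.seq (.inhale (.star (T.asrt I) (T.asrt (.bool b))))
        (.seq (T.main c) (.exhale (T.loopInv b I)))} ∪ aux c
  | .par P₁ c₁ Q₁ P₂ c₂ Q₂ =>
      {.seq (.inhale (T.asrt P₁)) (.seq (T.main c₁) (.exhale (T.asrt Q₁)))} ∪
      {.seq (.inhale (T.asrt P₂)) (.seq (T.main c₂) (.exhale (T.asrt Q₂)))} ∪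
      aux c₁ ∪ aux c₂

/-- The translation of a statement: main statement and auxiliary statements. -/
noncomputable def stmt (c : F.Stmt) : L.Stmt × Set L.Stmt := (T.main c, T.aux c)

/-- A front-end assertion with interpretation `A` is backward satisfiable with respect to its
translation `B`. -/
def BackwardSatisfiable {Δ : Ctx Var F.model} (A : Set (State Δ)) (B : Set (State (T.ctx Δ))) :
    Prop :=
  ∀ Ω ∈ B, (∃ ω_b : State Δ, Geq (T.state ω_b) Ω) → ∃ ω ∈ A, Geq Ω (T.state ω)

/-- The requirements on the translation of types and values. -/
structure TypeRequirements : Prop where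
  val_injective : Function.Injective T.val
  surj_of_haveInv_none : ∀ t, T.haveInv t = none → ∀ a, L.model.HasTy a (T.ty t) →
    ∃ a' : F.Val, F.tp a' = t ∧ T.val a' = a
  haveInv_iff : ∀ t e, T.haveInv t = some e → ∀ x Δ (Ω : State Δ) a, Ω.store x = some a →
    L.model.HasTy a (T.ty t) →
    (e x Δ Ω = some true ↔ ∃ a' : F.Val, F.tp a' = t ∧ T.val a' = a)
  haveInv_pure : ∀ t e, T.haveInv t = some e → ∀ x Δ, PureExpr (e x Δ)
  haveInv_monotone : ∀ t e, T.haveInv t = some e → ∀ x Δ, MonotoneExpr (e x Δ)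

/-- The requirements on the encoding of heaps: preservation of addition, of subtraction, and of
stability. -/
structure HeapRequirements : Prop where
  map_op : ∀ κ (φ₁ φ₂ φ : F.model.Heap κ), IDFAlgebra.op φ₁ φ₂ = some φ →
    IDFAlgebra.op (T.heap κ φ₁) (T.heap κ φ₂) = some (T.heap κ φ)
  map_sub : ∀ κ (φ φ₂ : F.model.Heap κ) (Φ₁ : L.model.Heap (T.heapCtx κ)),
    IDFAlgebra.op Φ₁ (T.heap κ φ₂) = some (T.heap κ φ) →
    ∃ φ₁ : F.model.Heap κ, Geq (T.heap κ φ₁) Φ₁ ∧ IDFAlgebra.op φ₁ φ₂ = some φ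
  map_stabilize : ∀ κ (φ : F.model.Heap κ),
    IDFAlgebra.stabilize (T.heap κ φ) = T.heap κ (IDFAlgebra.stabilize φ)

/-- The requirements on the translation of boolean expressions, input assertions and primitive
statements. -/
structure TranslationRequirements : Prop where
  be_preserved : ∀ b Δ (ω : State Δ), F.evalBE b Δ ω = T.be b (T.ctx Δ) (T.state ω)
  be_monotone : ∀ b Δ, MonotoneExpr (T.be b (T.ctx Δ))
  input_preserved : ∀ A Δ (ω : State Δ), ω ∈ F.interpIn A Δ ↔ T.state ω ∈ T.input A (T.ctx Δ)
  input_monotone : ∀ A Δ, Monotone (T.input A (T.ctx Δ))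
  input_backward : ∀ A Δ, T.BackwardSatisfiable (F.interpIn A Δ) (T.input A (T.ctx Δ))
  prim_preserved : ∀ Δ c, F.wfPrim Δ c → ∀ P Q, Monotone P → Monotone Q →
    L.AxSem (T.ctx Δ) P (T.prim c) Q → F.CSL Δ (T.btr P) (.prim c) (T.btr Q)
  /-- the axiomatic semantics is affine on translated primitive statements -/
  prim_affine : ∀ Δ c, F.wfPrim Δ c → ∀ P Q, L.AxSem (T.ctx Δ) P (T.prim c) Q →
    L.AxSem (T.ctx Δ) (monotonize P) (T.prim c) (monotonize Q)

end Translation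

end TransVerif

/-! The front-end proof is recovered from the IVL derivation by induction on `c`, with arbitrary IVL
conditions: a derivation of [P] m(c) [Q] yields {btr(P↑)} c {btr(Q↑)} (`CSL.of_main`). Arbitrary
sets are needed because the intermediate conditions of a derivation are not translations of
assertions. Upward closure is needed because subtraction of encoded heaps returns a remainder that
is only larger than the given one, and because primitive statements are controlled only for monotone
conditions. Translated assertions are monotone and btr inverts their translation, so the closure
disappears at the end.

Loops and parallel compositions carry the difficulty. Their translation exhales some A, havocs wr(c)
and inhales some B. The auxiliary statements, via the induction hypothesis for the bodies, give a
triple for `c` itself. Whatever condition R survives the exhale and the havocs is independent of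
wr(c), so btr(R↑) can be added by the frame rule (`CSL.of_exhale_havocs_inhale`). The postcondition
then follows from the homomorphism property. For the precondition, an IVL decomposition tr(ω) = r ⊕
Ω with Ω in the translation of A must become a front-end one: ω = ω' ⊕ a with a in A and tr(ω') ⪰ r.
This is `Splits`. For input assertions it follows from backward satisfiability and subtraction;
because the remainder r is arbitrary, it passes through the connectives (`faithful`). Boolean
expressions are pure, so the duplicable core satisfies them at no cost. -/

namespace TransVerif

open IDFAlgebra

/-! ### Order, separating conjunction and upward closure in an IDF algebra -/

section Algebra

variable {S : Type u} [IDFAlgebra S]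

theorem op_comm' {a b c : S} (h : op a b = some c) : op b a = some c := by
  rw [op_comm, h]

theorem op_assoc_right {a b c ab d : S} (h₁ : op a b = some ab) (h₂ : op ab c = some d) :
    ∃ bc, op b c = some bc ∧ op a bc = some d := by
  have h : ((op a b).bind fun ab => op ab c) = some d := by rw [h₁]; exact h₂
  rw [← op_assoc] at h
  exact Option.bind_eq_some_iff.1 h

theorem op_assoc_left {a b c bc d : S} (h₁ : op b c = some bc) (h₂ : op a bc = some d) :
    ∃ ab, op a b = some ab ∧ op ab c = some d := by
  have h : ((op b c).bind fun bc => op a bc) = some d := by rw [h₁]; exact h₂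
  rw [op_assoc] at h
  exact Option.bind_eq_some_iff.1 h

theorem geq_left {a b c : S} (h : op a b = some c) : Geq c a := ⟨b, h⟩

theorem geq_right {a b c : S} (h : op a b = some c) : Geq c b := ⟨a, op_comm' h⟩

theorem Geq.refl (a : S) : Geq a a := ⟨core a, op_core a⟩

theorem Geq.trans {a b c : S} (h₁ : Geq a b) (h₂ : Geq b c) : Geq a c := by
  obtain ⟨r, hr⟩ := h₁
  obtain ⟨s, hs⟩ := h₂
  obtain ⟨t, _, ht⟩ := op_assoc_right hs hr
  exact ⟨t, ht⟩

theorem geq_stabilize (a : S) : Geq a (stabilize a) := ⟨core a, op_stabilize_core a⟩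

theorem Geq.stabilize {a b : S} (h : Geq a b) :
    Geq (IDFAlgebra.stabilize a) (IDFAlgebra.stabilize b) := by
  obtain ⟨r, hr⟩ := h
  exact ⟨_, stabilize_op _ _ _ hr⟩

/-- Growing a summand that is known to fit: if `a = b ⊕ x` and `x ⪰ y`, then `a = b' ⊕ y`
with `b' ⪰ b`. -/
theorem op_shift {a b x y : S} (h : op b x = some a) (hxy : Geq x y) :
    ∃ b', Geq b' b ∧ op b' y = some a := by
  obtain ⟨r, hr⟩ := hxy
  obtain ⟨b', hb', h'⟩ := op_assoc_left (op_comm' hr) h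
  exact ⟨b', geq_left hb', h'⟩

theorem subset_monotonize (P : Set S) : P ⊆ monotonize P := fun ω h => ⟨ω, h, .refl ω⟩

theorem monotone_monotonize (P : Set S) : Monotone (monotonize P) := by
  rintro ω ⟨ω₀, h₀, h⟩ ω' h'
  exact ⟨ω₀, h₀, h'.trans h⟩

theorem Monotone.monotonize_eq {P : Set S} (hP : Monotone P) : monotonize P = P := by
  refine Set.Subset.antisymm ?_ (subset_monotonize P)
  rintro ω ⟨ω₀, h₀, h⟩
  exact hP _ h₀ _ h

theorem monotonize_union (P Q : Set S) :
    monotonize (P ∪ Q) = monotonize P ∪ monotonize Q := by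
  ext ω
  simp only [monotonize, Set.mem_union, Set.mem_ofPred_eq, or_and_right, exists_or]

theorem monotonize_mono {P Q : Set S} (h : P ⊆ Q) : monotonize P ⊆ monotonize Q := by
  rintro ω ⟨ω₀, h₀, hg⟩
  exact ⟨ω₀, h h₀, hg⟩

theorem sepConj_comm (P Q : Set S) : sepConj P Q = sepConj Q P := by
  ext ω
  constructor
  · rintro ⟨a, ha, b, hb, h⟩
    exact ⟨b, hb, a, ha, op_comm' h⟩
  · rintro ⟨a, ha, b, hb, h⟩
    exact ⟨b, hb, a, ha, op_comm' h⟩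

theorem sepConj_mono {P P' Q Q' : Set S} (hP : P ⊆ P') (hQ : Q ⊆ Q') :
    sepConj P Q ⊆ sepConj P' Q' := by
  rintro ω ⟨a, ha, b, hb, h⟩
  exact ⟨a, hP ha, b, hQ hb, h⟩

theorem Monotone.sepConj_left {P : Set S} (hP : Monotone P) (Q : Set S) :
    Monotone (sepConj P Q) := by
  rintro ω ⟨a, ha, b, hb, h⟩ ω' ⟨r, hr⟩
  obtain ⟨a', ha', h'⟩ := op_assoc_right (op_comm' h) hr
  exact ⟨a', hP _ ha _ (geq_left ha'), b, hb, op_comm' h'⟩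

theorem Monotone.sepConj_right {Q : Set S} (hQ : Monotone Q) (P : Set S) :
    Monotone (sepConj P Q) := by
  rw [sepConj_comm]
  exact hQ.sepConj_left P

/-- Closing one factor suffices: a surplus on the whole state can be credited to `P`, and conversely
a surplus within the `P`-part can be moved outside the sum. -/
theorem monotonize_sepConj (P Q : Set S) :
    monotonize (sepConj P Q) = sepConj (monotonize P) Q := by
  apply Set.Subset.antisymm
  · rw [← ((monotone_monotonize P).sepConj_left Q).monotonize_eq]
    exact monotonize_mono (sepConj_mono (subset_monotonize P) subset_rfl)
  · rintro ω ⟨a, ⟨a₀, ha₀, hg⟩, b, hb, h⟩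
    obtain ⟨c, hc, hcb⟩ := op_shift (op_comm' h) hg
    obtain ⟨r, hr⟩ := hc
    obtain ⟨d, hd, hdr⟩ := op_assoc_left hr (op_comm' hcb)
    exact ⟨d, ⟨a₀, ha₀, b, hb, hd⟩, r, hdr⟩

theorem Monotone.union {P Q : Set S} (hP : Monotone P) (hQ : Monotone Q) : Monotone (P ∪ Q) := by
  rintro ω (h | h) ω' hg
  · exact Or.inl (hP _ h _ hg)
  · exact Or.inr (hQ _ h _ hg)

/-- The core of a state is neutral for it, so it can fill the ⊤-part. This removes the precondition
⊤ of the auxiliary statements after their first inhale. -/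
theorem sepConj_univ_left {P : Set S} (hP : Monotone P) : sepConj Set.univ P = P := by
  ext ω
  constructor
  · rintro ⟨a, _, b, hb, h⟩
    exact hP _ hb _ (geq_right h)
  · intro h
    exact ⟨core ω, trivial, ω, h, op_comm' (op_core ω)⟩

theorem sepConj_subset_right (P : Set S) {Q : Set S} (hQ : Monotone Q) : sepConj P Q ⊆ Q := by
  rintro ω ⟨a, _, b, hb, h⟩
  exact hQ _ hb _ (geq_right h)

theorem SelfFraming.monotonize {P : Set S} (hP : SelfFraming P) :
    SelfFraming (monotonize P) := by
  intro ω
  constructor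
  · rintro ⟨ω₀, h₀, h⟩
    exact ⟨_, (hP _).1 h₀, h.stabilize⟩
  · rintro ⟨ω₀, h₀, h⟩
    exact ⟨ω₀, h₀, (geq_stabilize ω).trans h⟩

theorem SelfFraming.union {P Q : Set S} (hP : SelfFraming P) (hQ : SelfFraming Q) :
    SelfFraming (P ∪ Q) := fun ω => or_congr (hP ω) (hQ ω)

/-- Framing speaks only of stable states. Any sum p ⊕ a can be rebalanced so that its first part is
stable: replace p by its stabilization, still in `P`, and hand the core of p to a, which stays in
`A` by monotonicity. -/
theorem SelfFraming.sepConj_of_frames {P A : Set S} (hP : SelfFraming P) (hA : Monotone A)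
    (hPA : Frames P A) : SelfFraming (sepConj P A) := by
  have key : ∀ ω ∈ sepConj P A, ∃ p ∈ P, stable p ∧ ω ∈ sepConj {p} A := by
    rintro ω ⟨p, hp, a, ha, h⟩
    refine ⟨stabilize p, (hP p).1 hp, stable_stabilize p, _, rfl, ?_⟩
    obtain ⟨a', ha', h'⟩ := op_assoc_right (op_stabilize_core p) h
    exact ⟨a', hA _ ha _ (geq_right ha'), h'⟩
  intro ω
  constructor
  · intro h
    obtain ⟨p, hp, hs, hm⟩ := key _ h
    exact sepConj_mono (Set.singleton_subset_iff.2 hp) subset_rfl ((hPA p hp hs ω).1 hm)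
  · intro h
    obtain ⟨p, hp, hs, hm⟩ := key _ h
    exact sepConj_mono (Set.singleton_subset_iff.2 hp) subset_rfl ((hPA p hp hs ω).2 hm)

/-- A self-framing assertion may be strengthened by an expression that is stable under it. -/
theorem SelfFraming.inter_exprSet {A : Set S} {e : S → Option Bool}
    (hA : SelfFraming A) (he : StableUnder e A) (b : Bool) :
    SelfFraming (A ∩ exprSet e b) := by
  intro ω
  constructor
  · rintro ⟨h₁, h₂⟩
    exact ⟨(hA ω).1 h₁, (he ω h₁).symm.trans h₂⟩
  · rintro ⟨h₁, h₂⟩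
    exact ⟨(hA ω).2 h₁, (he ω ((hA ω).2 h₁)).trans h₂⟩

theorem MonotoneExpr.monotone_exprSet {e : S → Option Bool} (he : MonotoneExpr e) (b : Bool) :
    Monotone (exprSet e b) := fun ω h ω' hg => he ω ω' b h hg

end Algebra

/-! ### Typed states: variable updates, binding and independence -/

section States

variable {Var : Type w} {M : StateModel.{u}} {Δ : Ctx Var M}

theorem State.op_eq_some_iff {a b c : State Δ} :
    IDFAlgebra.op a b = some c ↔ a.store = c.store ∧ b.store = c.store ∧
      IDFAlgebra.op a.heap b.heap = some c.heap := State.op_eq_some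

theorem State.geq_iff {a b : State Δ} : Geq a b ↔ a.store = b.store ∧ Geq a.heap b.heap := by
  constructor
  · rintro ⟨r, hr⟩
    obtain ⟨h₁, h₂, h₃⟩ := State.op_eq_some_iff.1 hr
    exact ⟨h₁.symm, _, h₃⟩
  · rintro ⟨h₁, r, hr⟩
    exact ⟨{ a with heap := r }, State.op_eq_some_iff.2 ⟨h₁.symm, rfl, hr⟩⟩

theorem State.exists_store {x : Var} {t : M.Ty} (hx : Δ.vars x = some t) (ω : State Δ) :
    ∃ u, ω.store x = some u ∧ Δ.Admits x u := by
  have hω := ω.typed x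
  rw [hx] at hω
  cases hs : ω.store x with
  | none => rw [hs] at hω; cases hω
  | some u =>
    rw [hs] at hω
    cases hω with
    | some hu => exact ⟨u, rfl, t, hx, hu⟩

variable [DecidableEq Var]

theorem State.set_store_self {x : Var} {v : M.Val} (h : Δ.Admits x v) (ω : State Δ)
    (hv : ω.store x = some v) : ω.set x v h = ω := by
  ext1
  · simp only [State.set, ← hv, Function.update_eq_self]
  · rfl

theorem State.set_set {x : Var} {v v' : M.Val} (h : Δ.Admits x v) (h' : Δ.Admits x v')
    (ω : State Δ) : (ω.set x v h).set x v' h' = ω.set x v' h' := by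
  ext1
  · simp only [State.set, Function.update_idem]
  · rfl

theorem State.set_comm {x y : Var} (hxy : x ≠ y) {v v' : M.Val} (h : Δ.Admits x v)
    (h' : Δ.Admits y v') (ω : State Δ) :
    (ω.set x v h).set y v' h' = (ω.set y v' h').set x v h := by
  ext1
  · simp only [State.set, Function.update_comm hxy]
  · rfl

theorem State.stabilize_set {x : Var} {v : M.Val} (h : Δ.Admits x v) (ω : State Δ) :
    IDFAlgebra.stabilize (ω.set x v h) = (IDFAlgebra.stabilize ω).set x v h := rfl

theorem State.op_set {x : Var} {v : M.Val} (h : Δ.Admits x v) {a b c : State Δ}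
    (habc : IDFAlgebra.op a b = some c) :
    IDFAlgebra.op (a.set x v h) (b.set x v h) = some (c.set x v h) := by
  rw [State.op_eq_some_iff] at habc ⊢
  obtain ⟨h₁, h₂, h₃⟩ := habc
  exact ⟨by simp only [State.set, h₁], by simp only [State.set, h₂], h₃⟩

/-- It suffices to check one direction of independence. -/
theorem independentOf_of_imp {P : Set (State Δ)} {x : Var}
    (hP : ∀ ω ∈ P, ∀ (v : M.Val) (h : Δ.Admits x v), ω.set x v h ∈ P) : IndependentOf P x := by
  intro ω v h
  refine ⟨fun hω => hP ω hω v h, fun hω => ?_⟩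
  -- Writing back the old value `u` of `x` undoes the update, which gives the converse.
  obtain ⟨u, hu, hau⟩ := State.exists_store h.choose_spec.1 ω
  have := hP _ hω u hau
  rwa [State.set_set, State.set_store_self _ _ hu] at this

theorem IndependentOf.sepConj {P Q : Set (State Δ)} {x : Var} (hP : IndependentOf P x)
    (hQ : IndependentOf Q x) : IndependentOf (sepConj P Q) x := by
  apply independentOf_of_imp
  rintro ω ⟨a, ha, b, hb, hab⟩ v h
  exact ⟨_, (hP a v h).1 ha, _, (hQ b v h).1 hb, State.op_set h hab⟩

theorem IndependentOf.monotonize {P : Set (State Δ)} {x : Var} (hP : IndependentOf P x) :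
    IndependentOf (monotonize P) x := by
  apply independentOf_of_imp
  rintro ω ⟨ω₀, h₀, r, hr⟩ v h
  exact ⟨_, (hP ω₀ v h).1 h₀, _, State.op_set h hr⟩

theorem independentOf_existsVar_self (x : Var) (P : Set (State Δ)) :
    IndependentOf (existsVar x P) x := by
  apply independentOf_of_imp
  rintro ω ⟨u, hu, hm⟩ v h
  exact ⟨u, hu, by rwa [State.set_set]⟩

theorem IndependentOf.existsVar {P : Set (State Δ)} {x : Var} (hP : IndependentOf P x) (y : Var) :
    IndependentOf (existsVar y P) x := by
  by_cases hxy : x = y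
  · subst hxy
    exact independentOf_existsVar_self _ _
  apply independentOf_of_imp
  rintro ω ⟨u, hu, hm⟩ v h
  exact ⟨u, hu, by rw [State.set_comm hxy]; exact (hP _ v h).1 hm⟩

theorem SelfFraming.existsVar {P : Set (State Δ)} (hP : SelfFraming P) (x : Var) :
    SelfFraming (existsVar x P) := by
  intro ω
  refine exists_congr fun v => exists_congr fun h => ?_
  rw [hP, State.stabilize_set]

theorem subset_existsVar {P : Set (State Δ)} {x : Var} {t : M.Ty} (hx : Δ.vars x = some t) :
    P ⊆ existsVar x P := by
  intro ω hω
  obtain ⟨u, hu, ha⟩ := State.exists_store hx ω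
  exact ⟨u, ha, by rwa [State.set_store_self ha ω hu]⟩

theorem State.op_bindVar {x : Var} {t : M.Ty} {v : M.Val} (h : M.HasTy v t) {a b c : State Δ}
    (habc : IDFAlgebra.op a b = some c) :
    IDFAlgebra.op (a.bindVar x v h) (b.bindVar x v h) = some (c.bindVar x v h) := by
  rw [State.op_eq_some_iff] at habc ⊢
  obtain ⟨h₁, h₂, h₃⟩ := habc
  exact ⟨by simp only [State.bindVar, h₁], by simp only [State.bindVar, h₂], h₃⟩

theorem State.bindVar_set_self {x : Var} {t : M.Ty} {v u : M.Val} (hv : Δ.Admits x v)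
    (hu : M.HasTy u t) (ω : State Δ) : (ω.set x v hv).bindVar x u hu = ω.bindVar x u hu := by
  ext1
  · simp only [State.set, State.bindVar, Function.update_idem]
  · rfl

theorem Ctx.Admits.extend {x y : Var} (hxy : x ≠ y) {t : M.Ty} {v : M.Val} (hv : Δ.Admits x v) :
    (Δ.extend y t).Admits x v := by
  obtain ⟨s, hs, hvs⟩ := hv
  exact ⟨s, by simpa only [Ctx.extend, Function.update_of_ne hxy] using hs, hvs⟩

theorem State.bindVar_set {x y : Var} (hxy : x ≠ y) {t : M.Ty} {v u : M.Val} (hv : Δ.Admits x v)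
    (hu : M.HasTy u t) (ω : State Δ) :
    (ω.set x v hv).bindVar y u hu = (ω.bindVar y u hu).set x v (hv.extend hxy) := by
  ext1
  · simp only [State.set, State.bindVar, Function.update_comm hxy]
  · rfl

end States

/-! ### Front-end assertions depend only on their free variables -/

namespace FrontEnd

variable {Var : Type w} [DecidableEq Var] {F : FrontEnd.{u} Var}

/-- The induction ranges over all contexts, since a quantifier changes the context in which its body
is interpreted. -/
theorem Assertion.independentOf_interp (hF : F.Requirements) (A : F.Assertion) :
    ∀ (Δ : Ctx Var F.model), ∀ x ∉ A.fv, IndependentOf (A.interp Δ) x := by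
  induction A with
  | input A => exact hF.fv_in A
  | bool b =>
    intro Δ x hx ω v h
    simp only [interp, exprSet, Set.mem_ofPred_eq, ← hF.fv_be b Δ x hx ω v h]
  | star A₁ A₂ ih₁ ih₂ =>
    intro Δ x hx
    simp only [fv, Finset.mem_union, not_or] at hx
    exact (ih₁ Δ x hx.1).sepConj (ih₂ Δ x hx.2)
  | or A₁ A₂ ih₁ ih₂ =>
    intro Δ x hx ω v h
    simp only [fv, Finset.mem_union, not_or] at hx
    exact or_congr (ih₁ Δ x hx.1 ω v h) (ih₂ Δ x hx.2 ω v h)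
  | imp b A ih =>
    intro Δ x hx ω v h
    simp only [fv, Finset.mem_union, not_or] at hx
    simp only [interp, Set.mem_ofPred_eq, ← hF.fv_be b Δ x hx.1 ω v h, ← ih Δ x hx.2 ω v h]
  | ex y t A ih =>
    intro Δ x hx ω v h
    simp only [interp, Set.mem_ofPred_eq]
    by_cases hxy : x = y
    · subst hxy
      simp only [State.bindVar_set_self]
    · have hA : x ∉ A.fv := by
        intro hA
        exact hx (by simp only [fv, Finset.mem_sdiff, Finset.mem_singleton]; exact ⟨hA, hxy⟩)
      refine exists_congr fun u => exists_congr fun hu => ?_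
      rw [State.bindVar_set hxy]
      exact ih _ x hA _ v _

end FrontEnd

/-! ### Inversion of IVL derivations -/

namespace IVL

variable {Var : Type w} [DecidableEq Var] {L : IVL.{u} Var}

/-- The last conjunct makes the induction work: later havocs must not destroy the independence
gained by earlier ones. -/
theorem AxSem.havocList {Δ : Ctx Var L.model} (V : List Var) :
    ∀ {P Q : Set (State Δ)}, L.AxSem Δ P (Stmt.havocList V) Q →
      SelfFraming P ∧ SelfFraming Q ∧ P ⊆ Q ∧ (∀ x ∈ V, IndependentOf Q x) ∧
        ∀ x, IndependentOf P x → IndependentOf Q x := by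
  have single : ∀ {x : Var} {P Q : Set (State Δ)}, L.AxSem Δ P (.havoc x) Q →
      SelfFraming P ∧ SelfFraming Q ∧ P ⊆ Q ∧ IndependentOf Q x ∧
        ∀ y, IndependentOf P y → IndependentOf Q y := by
    intro x P Q h
    cases h with
    | havoc hP hx =>
      exact ⟨hP, hP.existsVar x, subset_existsVar hx, independentOf_existsVar_self x P,
        fun y hy => hy.existsVar x⟩
  match V with
  | [] =>
    intro P Q h
    cases h with
    | skip hP => exact ⟨hP, hP, subset_rfl, by simp, fun _ h => h⟩
  | [x] =>
    intro P Q h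
    obtain ⟨h₁, h₂, h₃, h₄, h₅⟩ := single h
    exact ⟨h₁, h₂, h₃, by simpa using h₄, h₅⟩
  | x :: y :: l =>
    intro P Q h
    cases h with
    | seq hx hl =>
      obtain ⟨h₁, h₂, h₃, h₄, h₅⟩ := single hx
      obtain ⟨k₁, k₂, k₃, k₄, k₅⟩ := AxSem.havocList (y :: l) hl
      refine ⟨h₁, k₂, h₃.trans k₃, ?_, fun z hz => k₅ z (h₅ z hz)⟩
      intro z hz
      rcases List.mem_cons.1 hz with rfl | hz
      · exact k₅ _ h₄
      · exact k₄ z hz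

/-- The effect of `exhale A; havoc V; inhale B`, for a monotone assertion `B`. -/
theorem AxSem.exhale_havocs_inhale {Δ : Ctx Var L.model} {P Q : Set (State Δ)} {A B : L.Assertion}
    {V : Finset Var} (hB : Monotone (B Δ))
    (h : L.AxSem Δ P (.seq (.exhale A) (.seq (.havocs V) (.inhale B))) Q) :
    SelfFraming P ∧ SelfFraming Q ∧ ∃ R : Set (State Δ), SelfFraming R ∧
      (∀ x ∈ V, IndependentOf R x) ∧ P ⊆ sepConj R (A Δ) ∧ Q = sepConj R (B Δ) := by
  cases h with
  | seq h₁ h₂ =>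
    cases h₂ with
    | seq h₂ h₃ =>
      cases h₁ with
      | exhale hP hPR _ =>
        cases h₃ with
        | inhale hR hf =>
          obtain ⟨_, _, hsub, hind, _⟩ := AxSem.havocList _ h₂
          exact ⟨hP, hR.sepConj_of_frames hB hf, _, hR,
            fun x hx => hind x (Finset.mem_toList.2 hx),
            hPR.trans (sepConj_mono hsub subset_rfl), rfl⟩

/-- The effect of `inhale A; C; exhale B` from the precondition `⊤`. -/
theorem AxSem.inhale_exhale {Δ : Ctx Var L.model} {Q : Set (State Δ)} {A B : L.Assertion}
    {C : L.Stmt} (h : L.AxSem Δ Set.univ (.seq (.inhale A) (.seq C (.exhale B))) Q) :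
    ∃ R, L.AxSem Δ (sepConj Set.univ (A Δ)) C R ∧ R ⊆ sepConj Q (B Δ) := by
  cases h with
  | seq h₁ h₂ =>
    cases h₂ with
    | seq h₂ h₃ =>
      cases h₁ with
      | inhale _ _ =>
        cases h₃ with
        | exhale _ hsub _ => exact ⟨_, h₂, hsub⟩

end IVL

/-! ### Encoded states and splitting off parts of them -/

namespace Translation

variable {Var : Type w} {F : FrontEnd.{u} Var} {L : IVL.{v} Var} {T : Translation F L}
variable {Δ : Ctx Var F.model}

theorem state_op (hheap : T.HeapRequirements) {a b c : State Δ} (h : op a b = some c) :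
    op (T.state a) (T.state b) = some (T.state c) := by
  rw [State.op_eq_some_iff] at h ⊢
  obtain ⟨h₁, h₂, h₃⟩ := h
  exact ⟨by simp only [state, h₁], by simp only [state, h₂], hheap.map_op _ _ _ _ h₃⟩

theorem state_geq (hheap : T.HeapRequirements) {a b : State Δ} (h : Geq a b) :
    Geq (T.state a) (T.state b) := by
  obtain ⟨r, hr⟩ := h
  exact ⟨_, state_op hheap hr⟩

theorem state_stabilize (hheap : T.HeapRequirements) (a : State Δ) :
    stabilize (T.state a) = T.state (stabilize a) := by
  ext1
  · rfl
  · exact hheap.map_stabilize _ _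

/-- Injectivity on values turns equality of encoded stores into equality of stores; the heaps are
handled by the subtraction requirement, which is why the remainder is only bounded below by `r`. -/
theorem state_sub (hty : T.TypeRequirements) (hheap : T.HeapRequirements) {a b : State Δ}
    {r : State (T.ctx Δ)} (h : op r (T.state b) = some (T.state a)) :
    ∃ a' : State Δ, Geq (T.state a') r ∧ op a' b = some a := by
  obtain ⟨h₁, h₂, h₃⟩ := State.op_eq_some_iff.1 h
  obtain ⟨φ, hφ, hφ'⟩ := hheap.map_sub _ _ _ _ h₃
  have hs : b.store = a.store := by
    funext x
    exact Option.map_injective hty.val_injective (congrFun h₂ x)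
  exact ⟨{ a with heap := φ }, State.geq_iff.2 ⟨h₁.symm, hφ⟩,
    State.op_eq_some_iff.2 ⟨rfl, hs, hφ'⟩⟩

theorem btr_mono {A B : Set (State (T.ctx Δ))} (h : A ⊆ B) : T.btr A ⊆ T.btr B :=
  fun _ hω => h hω

theorem selfFraming_btr (hheap : T.HeapRequirements) {A : Set (State (T.ctx Δ))}
    (hA : SelfFraming A) : SelfFraming (T.btr A) := by
  intro ω
  have := hA (T.state ω)
  rwa [state_stabilize hheap] at this

theorem sepConj_btr_subset (hheap : T.HeapRequirements) (A B : Set (State (T.ctx Δ))) :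
    sepConj (T.btr A) (T.btr B) ⊆ T.btr (sepConj A B) := by
  rintro ω ⟨a, ha, b, hb, h⟩
  exact ⟨_, ha, _, hb, state_op hheap h⟩

/-- A part of an encoded state that satisfies `B` can be split off in the front-end. -/
def Splits (T : Translation F L) (A : Set (State Δ)) (B : Set (State (T.ctx Δ))) : Prop :=
  ∀ Ω ∈ B, ∀ (r : State (T.ctx Δ)) (ω : State Δ), op Ω r = some (T.state ω) →
    ∃ a ∈ A, ∃ ω', op ω' a = some ω ∧ Geq (T.state ω') r

/-- Backward satisfiability replaces `Ω` by a smaller encoded state; the surplus is moved into the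
remainder, and the encoded state can then be subtracted. -/
theorem BackwardSatisfiable.splits (hty : T.TypeRequirements) (hheap : T.HeapRequirements)
    {A : Set (State Δ)} {B : Set (State (T.ctx Δ))} (h : T.BackwardSatisfiable A B) :
    T.Splits A B := by
  intro Ω hΩ r ω hr
  obtain ⟨a, ha, hg⟩ := h Ω hΩ ⟨ω, geq_left hr⟩
  obtain ⟨r', hr', hop⟩ := op_shift (op_comm' hr) hg
  obtain ⟨ω', hω', hop'⟩ := state_sub hty hheap hop
  exact ⟨a, ha, ω', hop', hω'.trans hr'⟩

theorem Splits.sepConj {A₁ A₂ : Set (State Δ)} {B₁ B₂ : Set (State (T.ctx Δ))}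
    (h₁ : T.Splits A₁ B₁) (h₂ : T.Splits A₂ B₂) :
    T.Splits (sepConj A₁ A₂) (sepConj B₁ B₂) := by
  rintro Ω ⟨Ω₁, hΩ₁, Ω₂, hΩ₂, hΩ⟩ r ω hr
  obtain ⟨s, hs, hr⟩ := op_assoc_right hΩ hr
  -- The second part is split off from what the first leaves, with remainder `r` enlarged by the
  -- surplus `t`.
  obtain ⟨a₁, ha₁, ω', hop, t, ht⟩ := h₁ Ω₁ hΩ₁ s ω hr
  obtain ⟨r', hr', hop'⟩ := op_assoc_right hs ht
  obtain ⟨a₂, ha₂, ω'', hop₂, hg⟩ := h₂ Ω₂ hΩ₂ r' ω' hop'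
  obtain ⟨a, ha, hω⟩ := op_assoc_right hop₂ hop
  exact ⟨a, ⟨a₁, ha₁, a₂, ha₂, op_comm' ha⟩, ω'', hω, hg.trans (geq_left hr')⟩

theorem Splits.union {A₁ A₂ : Set (State Δ)} {B₁ B₂ : Set (State (T.ctx Δ))}
    (h₁ : T.Splits A₁ B₁) (h₂ : T.Splits A₂ B₂) : T.Splits (A₁ ∪ A₂) (B₁ ∪ B₂) := by
  rintro Ω (hΩ | hΩ) r ω hr
  · obtain ⟨a, ha, h⟩ := h₁ Ω hΩ r ω hr
    exact ⟨a, Or.inl ha, h⟩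
  · obtain ⟨a, ha, h⟩ := h₂ Ω hΩ r ω hr
    exact ⟨a, Or.inr ha, h⟩

/-- Splitting off a part that satisfies a separating conjunction gives back a larger part of
the front-end state. -/
theorem Splits.btr_sepConj_subset {A : Set (State Δ)} {B R : Set (State (T.ctx Δ))}
    (h : T.Splits A B) (hR : Monotone R) :
    T.btr (TransVerif.sepConj R B) ⊆ TransVerif.sepConj A (T.btr R) := by
  rintro ω ⟨r, hr, Ω, hΩ, hop⟩
  obtain ⟨a, ha, ω', hop', hg⟩ := h Ω hΩ r ω (op_comm' hop)
  exact ⟨a, ha, ω', hR _ hr _ hg, op_comm' hop'⟩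

/-- The contexts tr(Δ[x ↦ t]) and tr(Δ)[x ↦ tr(t)] are only propositionally equal; comparing stores
and heaps avoids casts between their types of states. -/
theorem mem_congr (A : L.Assertion) {V₁ V₂ : Var → Option L.model.Ty} {κ : L.model.HeapCtx}
    (hV : V₁ = V₂) (Ω₁ : State (⟨V₁, κ⟩ : Ctx Var L.model)) (Ω₂ : State ⟨V₂, κ⟩)
    (hs : Ω₁.store = Ω₂.store) (hh : Ω₁.heap = Ω₂.heap) : Ω₁ ∈ A _ ↔ Ω₂ ∈ A _ := by
  subst hV
  have : Ω₁ = Ω₂ := State.ext hs hh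
  rw [this]

variable [DecidableEq Var]

theorem monotoneExpr_evalBE (hheap : T.HeapRequirements) (htr : T.TranslationRequirements)
    (b : F.BE) : MonotoneExpr (F.evalBE b Δ) := by
  intro ω ω' a h hg
  rw [htr.be_preserved] at h ⊢
  exact htr.be_monotone b Δ _ _ a h (state_geq hheap hg)

/-- A part of an encoded state on which `b` is defined leaves the whole state when it is
removed, since `b` holds of the core. -/
theorem splits_exprSet (hF : F.Requirements) (htr : T.TranslationRequirements) (b : F.BE)
    (a : Bool) : T.Splits (exprSet (F.evalBE b Δ) a) (exprSet (T.be b (T.ctx Δ)) a) := by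
  intro Ω hΩ r ω hr
  -- Splitting off the core leaves all of `ω`; the value of `b` passes from `Ω` to the larger tr(ω),
  -- hence to `ω`, and by purity to its core.
  refine ⟨core ω, ?_, ω, op_core ω, geq_right hr⟩
  simp only [exprSet, Set.mem_ofPred_eq]
  rw [← hF.pure_be b Δ ω, htr.be_preserved]
  exact htr.be_monotone b Δ _ _ a hΩ (geq_left hr)

/-- If `B` determines the value `a` of `b`, then so does the part that is split off. -/
theorem Splits.inter_exprSet (hF : F.Requirements) (hheap : T.HeapRequirements)
    (htr : T.TranslationRequirements) {A : Set (State Δ)} {B : Set (State (T.ctx Δ))}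
    (h : T.Splits A B) (hA : Monotone A) (b : F.BE) (a : Bool)
    (hB : B ⊆ exprSet (T.be b (T.ctx Δ)) a) : T.Splits (A ∩ exprSet (F.evalBE b Δ) a) B := by
  intro Ω hΩ r ω hr
  obtain ⟨ω₁, hω₁, ω', hop, hg⟩ := h Ω hΩ r ω hr
  -- The core of the whole state, which determines `b`, is added to the part split off.
  obtain ⟨ω₂, h₂, h₂'⟩ := op_assoc_right hop (op_core ω)
  refine ⟨ω₂, ⟨hA _ hω₁ _ (geq_left h₂), ?_⟩, ω', h₂', hg⟩
  obtain ⟨ω₃, hω₃, ω₄, hop₄, -⟩ := splits_exprSet hF htr b a Ω (hB hΩ) r ω hr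
  refine monotoneExpr_evalBE hheap htr b (core ω) ω₂ a ?_ (geq_right h₂)
  rw [← hF.pure_be b Δ ω]
  exact monotoneExpr_evalBE hheap htr b ω₃ ω a hω₃ (geq_right hop₄)

theorem ctx_extend (x : Var) (t : F.Ty) :
    T.ctx (Δ.extend x t) = (T.ctx Δ).extend x (T.ty t) := by
  ext y
  · simp only [ctx, Ctx.extend, Function.update_apply]
    split_ifs <;> rfl
  · rfl

end Translation

/-! ### Faithfulness of the translation of assertions -/

namespace Translation

variable {Var : Type w} {F : FrontEnd.{u} Var} {L : IVL.{v} Var} {T : Translation F L}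

theorem Splits.mono {Δ : Ctx Var F.model} {A A' : Set (State Δ)} {B B' : Set (State (T.ctx Δ))}
    (h : T.Splits A B) (hA : A ⊆ A') (hB : B' ⊆ B) : T.Splits A' B' := by
  intro Ω hΩ r ω hr
  obtain ⟨a, ha, h⟩ := h Ω (hB hΩ) r ω hr
  exact ⟨a, hA ha, h⟩

/-- Splitting with the core as remainder. -/
theorem Splits.btr_subset {Δ : Ctx Var F.model} {A : Set (State Δ)} {B : Set (State (T.ctx Δ))}
    (h : T.Splits A B) (hA : Monotone A) : T.btr B ⊆ A := by
  intro ω hω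
  obtain ⟨a, ha, ω', hop, -⟩ := h _ hω _ ω (op_core _)
  exact hA _ ha _ (geq_right hop)

/-- Disjunction is strict in definedness, so the tautology expresses exactly that `e` is defined. -/
theorem mem_ofExpr_or_not {e : L.Expr} {Δ' : Ctx Var L.model} {Ω : State Δ'} :
    Ω ∈ IVL.Assertion.ofExpr (.or e (.not e)) Δ' ↔ (e Δ' Ω).isSome := by
  simp only [IVL.Assertion.ofExpr, exprSet, Set.mem_ofPred_eq, IVL.Expr.or, IVL.Expr.not]
  rcases e Δ' Ω with _ | _ | _ <;> simp

theorem ofExpr_not (e : L.Expr) (Δ' : Ctx Var L.model) :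
    IVL.Assertion.ofExpr (.not e) Δ' = exprSet (e Δ') false := by
  ext Ω
  simp only [IVL.Assertion.ofExpr, exprSet, Set.mem_ofPred_eq, IVL.Expr.not]
  rcases e Δ' Ω with _ | _ | _ <;> simp

variable [DecidableEq Var]

/-- The body of the translation of `∃ x : t. A`. -/
def exBody (T : Translation F L) (x : Var) (t : F.Ty) (A : F.Assertion) : L.Assertion :=
  match T.haveInv t with
  | none => T.asrt A
  | some e => .star (.ofExpr (e x)) (T.asrt A)

theorem exBody_of_none {t : F.Ty} (h : T.haveInv t = none) (x : Var) (A : F.Assertion) :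
    T.exBody x t A = T.asrt A := by
  simp only [exBody, h]

theorem exBody_of_some {t : F.Ty} {e : Var → L.Expr} (h : T.haveInv t = some e) (x : Var)
    (A : F.Assertion) : T.exBody x t A = .star (.ofExpr (e x)) (T.asrt A) := by
  simp only [exBody, h]

theorem exBody_subset {x : Var} {t : F.Ty} {A : F.Assertion} {Δ : Ctx Var L.model}
    (hA : Monotone (T.asrt A Δ)) : T.exBody x t A Δ ⊆ T.asrt A Δ := by
  rcases h : T.haveInv t with _ | e
  · rw [exBody_of_none h]
  · rw [exBody_of_some h]
    exact sepConj_subset_right _ hA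

theorem monotone_exBody {x : Var} {t : F.Ty} {A : F.Assertion} {Δ : Ctx Var L.model}
    (hA : Monotone (T.asrt A Δ)) : Monotone (T.exBody x t A Δ) := by
  rcases h : T.haveInv t with _ | e
  · rwa [exBody_of_none h]
  · rw [exBody_of_some h]
    exact hA.sepConj_right _

/-- Without an invariant the encoding is onto the translated type; otherwise the summand satisfying
the invariant has the same store as `Ω`. -/
theorem exists_val_of_mem_exBody (hty : T.TypeRequirements) {x : Var} {t : F.Ty}
    {A : F.Assertion} {Δ : Ctx Var L.model} {Ω : State Δ} (hΩ : Ω ∈ T.exBody x t A Δ)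
    {v : L.model.Val} (hv : L.model.HasTy v (T.ty t)) (hx : Ω.store x = some v) :
    ∃ a : F.Val, F.tp a = t ∧ T.val a = v := by
  rcases h : T.haveInv t with _ | e
  · exact hty.surj_of_haveInv_none t h v hv
  · rw [exBody_of_some h] at hΩ
    obtain ⟨Ω₁, h₁, Ω₂, _, hop⟩ := hΩ
    obtain ⟨hs, _, _⟩ := State.op_eq_some_iff.1 hop
    exact (hty.haveInv_iff t e h x Δ Ω₁ v (by rw [hs, hx]) hv).1 h₁

theorem mem_exBody (hty : T.TypeRequirements) {x : Var} {t : F.Ty}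
    {A : F.Assertion} {Δ : Ctx Var L.model} {Ω : State Δ} (hΩ : Ω ∈ T.asrt A Δ)
    {a : F.Val} (ha : F.tp a = t) (hx : Ω.store x = some (T.val a)) :
    Ω ∈ T.exBody x t A Δ := by
  rcases h : T.haveInv t with _ | e
  · rwa [exBody_of_none h]
  · rw [exBody_of_some h]
    -- The invariant is pure, so the core satisfies it and `Ω` stays available for the body.
    refine ⟨core Ω, ?_, Ω, hΩ, op_comm' (op_core Ω)⟩
    have he := (hty.haveInv_iff t e h x Δ Ω _ hx (ha ▸ T.val_typed a)).2 ⟨a, ha, rfl⟩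
    rw [hty.haveInv_pure t e h x Δ Ω] at he
    exact he

theorem mem_asrt_bindVar_iff {Δ : Ctx Var F.model} (B : L.Assertion) (ω : State Δ) (x : Var)
    {t : F.Ty} (a : F.Val) (ha : F.tp a = t) (h : L.model.HasTy (T.val a) (T.ty t)) :
    (T.state ω).bindVar x (T.val a) h ∈ B ((T.ctx Δ).extend x (T.ty t)) ↔
      T.state (ω.bindVar x (t := t) a ha) ∈ B (T.ctx (Δ.extend x t)) := by
  refine mem_congr B (congrArg Ctx.vars (ctx_extend x t)).symm _ _ ?_ rfl
  funext y
  simp only [State.bindVar, state, Function.update_apply]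
  split_ifs <;> rfl

/-- The translation of assertions preserves and reflects satisfaction, its results are monotone,
and parts that satisfy the translation can be split off in the front-end. -/
structure Faithful (T : Translation F L) (A : F.Assertion) (Δ : Ctx Var F.model) : Prop where
  mem_iff : ∀ ω : State Δ, ω ∈ A.interp Δ ↔ T.state ω ∈ T.asrt A (T.ctx Δ)
  monotone : Monotone (T.asrt A (T.ctx Δ))
  splits : T.Splits (A.interp Δ) (T.asrt A (T.ctx Δ))

theorem Faithful.monotone_interp (hheap : T.HeapRequirements) {A : F.Assertion}
    {Δ : Ctx Var F.model} (h : T.Faithful A Δ) : Monotone (A.interp Δ) := by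
  intro ω hω ω' hg
  rw [h.mem_iff] at hω ⊢
  exact h.monotone _ hω _ (state_geq hheap hg)

theorem Faithful.btr_eq {A : F.Assertion} {Δ : Ctx Var F.model} (h : T.Faithful A Δ) :
    T.btr (T.asrt A (T.ctx Δ)) = A.interp Δ := by
  ext ω
  exact (h.mem_iff ω).symm

/-- An IVL witness is the encoding of a front-end value, by the invariant or by surjectivity.
Binding changes only the store, so the splitting of the body carries over on heaps. -/
theorem faithful_ex (hty : T.TypeRequirements) {A : F.Assertion}
    {x : Var} {t : F.Ty} {Δ : Ctx Var F.model} (h : T.Faithful A (Δ.extend x t)) :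
    T.Faithful (.ex x t A) Δ := by
  have hmono : Monotone (T.asrt A ((T.ctx Δ).extend x (T.ty t))) := ctx_extend x t ▸ h.monotone
  have decode : ∀ {Ω : State (T.ctx Δ)} {v : L.model.Val} {hv : L.model.HasTy v (T.ty t)},
      Ω.bindVar x v hv ∈ T.exBody x t A ((T.ctx Δ).extend x (T.ty t)) →
        ∃ a : F.Val, F.tp a = t ∧ T.val a = v := fun {Ω v hv} hm =>
    exists_val_of_mem_exBody hty hm hv (Function.update_self ..)
  refine ⟨fun ω => ⟨?_, ?_⟩, ?_, ?_⟩
  · rintro ⟨a, ha, hm⟩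
    refine ⟨T.val a, ha ▸ T.val_typed a, mem_exBody hty ?_ ha (Function.update_self ..)⟩
    rw [mem_asrt_bindVar_iff _ _ _ _ ha, ← h.mem_iff]
    exact hm
  · rintro ⟨v, hv, hm⟩
    obtain ⟨a, ha, rfl⟩ := decode hm
    refine ⟨a, ha, ?_⟩
    rw [h.mem_iff, ← mem_asrt_bindVar_iff _ _ _ _ ha hv]
    exact exBody_subset hmono hm
  · rintro Ω ⟨v, hv, hm⟩ Ω' ⟨r, hr⟩
    exact ⟨v, hv, monotone_exBody hmono _ hm _ ⟨_, State.op_bindVar hv hr⟩⟩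
  · rintro Ω ⟨v, hv, hm⟩ r ω hr
    obtain ⟨a, ha, rfl⟩ := decode hm
    have hmem := exBody_subset hmono hm
    have hop := State.op_bindVar (x := x) hv hr
    obtain ⟨h₁, h₂, h₃⟩ := State.op_eq_some_iff.1 hr
    have hs : (T.state (ω.bindVar x (t := t) a ha)).store =
        ((T.state ω).bindVar x (T.val a) hv).store := by
      funext y
      simp only [State.bindVar, state, Function.update_apply]
      split_ifs <;> rfl
    -- `Ω₁` and `r₁` are `Ω` and `r` with `x` bound, but typed in the context for which the
    -- splitting of the body is stated.
    let Ω₁ : State (T.ctx (Δ.extend x t)) :=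
      { T.state (ω.bindVar x (t := t) a ha) with heap := Ω.heap }
    let r₁ : State (T.ctx (Δ.extend x t)) :=
      { T.state (ω.bindVar x (t := t) a ha) with heap := r.heap }
    have hΩ₁ : Ω₁ ∈ T.asrt A (T.ctx (Δ.extend x t)) := by
      refine (mem_congr (T.asrt A) (congrArg Ctx.vars (ctx_extend x t)) Ω₁
        (Ω.bindVar x (T.val a) hv) ?_ rfl).2 hmem
      rw [show (Ω.bindVar x (T.val a) hv).store = ((T.state ω).bindVar x (T.val a) hv).store by
        simp only [State.bindVar, h₁]]
      exact hs
    obtain ⟨ω₁, hω₁, ω', hop', hg⟩ := h.splits Ω₁ hΩ₁ r₁ (ω.bindVar x a ha)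
      (State.op_eq_some_iff.2 ⟨rfl, rfl, h₃⟩)
    obtain ⟨k₁, k₂, k₃⟩ := State.op_eq_some_iff.1 hop'
    -- The heaps of the splitting are kept, and the store is reset to that of `ω`.
    refine ⟨{ ω with heap := ω₁.heap }, ⟨a, ha, ?_⟩, { ω with heap := ω'.heap },
      State.op_eq_some_iff.2 ⟨rfl, rfl, k₃⟩, State.geq_iff.2 ⟨h₂.symm, (State.geq_iff.1 hg).2⟩⟩
    have heq : State.bindVar (Δ := Δ) { ω with heap := ω₁.heap } x (t := t) a ha = ω₁ := by
      ext1
      · exact k₂.symm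
      · rfl
    rw [heq]
    exact hω₁

theorem faithful (hF : F.Requirements) (hty : T.TypeRequirements) (hheap : T.HeapRequirements)
    (htr : T.TranslationRequirements) (A : F.Assertion) :
    ∀ Δ : Ctx Var F.model, T.Faithful A Δ := by
  have bool_iff : ∀ b a (Δ : Ctx Var F.model) (ω : State Δ), F.evalBE b Δ ω = some a ↔
      T.be b (T.ctx Δ) (T.state ω) = some a := by
    intro b a Δ ω
    rw [htr.be_preserved]
  induction A with
  | input A =>
    exact fun Δ => ⟨htr.input_preserved A Δ, htr.input_monotone A Δ,
      (htr.input_backward A Δ).splits hty hheap⟩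
  | bool b =>
    exact fun Δ => ⟨bool_iff b true Δ, (htr.be_monotone b Δ).monotone_exprSet true,
      splits_exprSet hF htr b true⟩
  | star A₁ A₂ ih₁ ih₂ =>
    intro Δ
    have hs := (ih₁ Δ).splits.sepConj (ih₂ Δ).splits
    refine ⟨fun ω => ⟨?_, fun h => ?_⟩, (ih₁ Δ).monotone.sepConj_left _, hs⟩
    · intro h
      refine sepConj_btr_subset hheap _ _ ?_
      rw [(ih₁ Δ).btr_eq, (ih₂ Δ).btr_eq]
      exact h
    -- The summands of an encoded state need not be encoded states; splitting supplies front-end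
    -- ones.
    · exact hs.btr_subset (((ih₁ Δ).monotone_interp hheap).sepConj_left _) h
  | or A₁ A₂ ih₁ ih₂ =>
    exact fun Δ => ⟨fun ω => or_congr ((ih₁ Δ).mem_iff ω) ((ih₂ Δ).mem_iff ω),
      (ih₁ Δ).monotone.union (ih₂ Δ).monotone, (ih₁ Δ).splits.union (ih₂ Δ).splits⟩
  | imp b A ih =>
    intro Δ
    refine ⟨fun ω => exists_congr fun a => and_congr (bool_iff b a Δ ω)
      (imp_congr_right fun _ => (ih Δ).mem_iff ω), ?_, ?_⟩
    · rintro Ω ⟨a, hb, hA⟩ Ω' hg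
      exact ⟨a, htr.be_monotone b Δ _ _ a hb hg, fun ha => (ih Δ).monotone _ (hA ha) _ hg⟩
    · rintro Ω ⟨a, hb, hA⟩ r ω hr
      cases a with
      | true =>
        -- The part split off must satisfy `A` and also make `b` true by itself.
        obtain ⟨ω₁, hω₁, h⟩ := ((ih Δ).splits.mono subset_rfl Set.inter_subset_left).inter_exprSet
          hF hheap htr ((ih Δ).monotone_interp hheap) b true Set.inter_subset_right
          Ω ⟨hA rfl, hb⟩ r ω hr
        exact ⟨ω₁, ⟨true, hω₁.2, fun _ => hω₁.1⟩, h⟩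
      | false =>
        obtain ⟨ω₁, hω₁, h⟩ := splits_exprSet hF htr b false Ω hb r ω hr
        exact ⟨ω₁, ⟨false, hω₁, fun h => absurd h Bool.false_ne_true⟩, h⟩
  | ex x t A ih => exact fun Δ => faithful_ex hty (ih _)

variable {Δ : Ctx Var F.model}

/-- A boolean expression that is known to be defined is added to an encoded assertion by
duplicating the core. -/
theorem btr_sepConj_exprSet (hF : F.Requirements) (htr : T.TranslationRequirements)
    (hheap : T.HeapRequirements) {A : Set (State (T.ctx Δ))} (hA : Monotone A) (b : F.BE)
    (a : Bool) :
    T.btr (sepConj A (exprSet (T.be b (T.ctx Δ)) a)) = T.btr A ∩ exprSet (F.evalBE b Δ) a := by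
  apply Set.Subset.antisymm
  · rintro ω ⟨Ω₁, h₁, Ω₂, h₂, hop⟩
    refine ⟨hA _ h₁ _ (geq_left hop), ?_⟩
    simp only [exprSet, Set.mem_ofPred_eq, htr.be_preserved]
    exact htr.be_monotone b Δ _ _ a h₂ (geq_right hop)
  · rintro ω ⟨h₁, h₂⟩
    refine ⟨_, h₁, T.state (core ω), ?_, state_op hheap (op_core ω)⟩
    simp only [exprSet, Set.mem_ofPred_eq] at h₂ ⊢
    rw [← htr.be_preserved, ← hF.pure_be b Δ ω, h₂]

theorem loopInv_eq (b : F.BE) (I : F.Assertion) (Δ' : Ctx Var L.model) :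
    T.loopInv b I Δ' = sepConj (T.asrt I Δ') (exprSet (T.be b Δ') true) ∪
      sepConj (T.asrt I Δ') (exprSet (T.be b Δ') false) := by
  ext Ω
  constructor
  · rintro ⟨Ω₁, h₁, Ω₂, h₂, hop⟩
    obtain ⟨a, ha⟩ := Option.isSome_iff_exists.1 (mem_ofExpr_or_not.1 h₂)
    cases a with
    | true => exact Or.inl ⟨Ω₁, h₁, Ω₂, ha, hop⟩
    | false => exact Or.inr ⟨Ω₁, h₁, Ω₂, ha, hop⟩
  · rintro (⟨Ω₁, h₁, Ω₂, h₂, hop⟩ | ⟨Ω₁, h₁, Ω₂, h₂, hop⟩)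
    all_goals
      refine ⟨Ω₁, h₁, Ω₂, mem_ofExpr_or_not.2 ?_, hop⟩
      rw [show T.be b Δ' Ω₂ = some _ from h₂]
      rfl

end Translation

/-! ### Reconstruction of the front-end proof -/

namespace FrontEnd

variable {Var : Type w} [DecidableEq Var] {F : FrontEnd.{u} Var} {L : IVL.{v} Var}
variable {T : Translation F L} {Δ : Ctx Var F.model}

/-- The rule for a statement whose translation exhales `A'`, havocs its modified variables and
inhales `B'`: the assertion that is left after exhaling is a frame. -/
theorem CSL.of_exhale_havocs_inhale (hheap : T.HeapRequirements)
    {c : F.Stmt} {A B : Set (State Δ)}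
    {A' B' : L.Assertion} {P Q : Set (State (T.ctx Δ))} (hc : F.CSL Δ A c B)
    (hA : T.Splits A (A' (T.ctx Δ))) (hB : B ⊆ T.btr (B' (T.ctx Δ)))
    (hB' : Monotone (B' (T.ctx Δ)))
    (h : L.AxSem (T.ctx Δ) P (.seq (.exhale A') (.seq (.havocs c.wr) (.inhale B'))) Q) :
    F.CSL Δ (T.btr (monotonize P)) c (T.btr (monotonize Q)) := by
  obtain ⟨hP, hQ, R, hR, hind, hsub, rfl⟩ := h.exhale_havocs_inhale hB'
  refine .conseq (.frame hc (Translation.selfFraming_btr hheap hR.monotonize) ?_) ?_ ?_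
    (Translation.selfFraming_btr hheap hP.monotonize)
    (Translation.selfFraming_btr hheap hQ.monotonize)
  · intro x hx ω v hv
    -- A front-end update is encoded as an update with the encoded value, so independence of the
    -- frame is inherited.
    have := (hind x hx).monotonize (T.state ω) (T.val v)
    obtain ⟨t, ht, rfl⟩ := hv
    have had : (T.ctx Δ).Admits x (T.val v) :=
      ⟨T.ty (F.tp v), by simp only [Translation.ctx, ht, Option.map_some], T.val_typed v⟩
    have heq : T.state (ω.set x v ⟨_, ht, rfl⟩) = (T.state ω).set x (T.val v) had := by
      ext1
      · funext y
        simp only [State.set, Translation.state, Function.update_apply]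
        split_ifs <;> rfl
      · rfl
    simp only [Translation.btr, Set.mem_ofPred_eq, heq]
    exact this had
  -- The remainder after splitting may exceed one in `R`; the closure of `R` absorbs the excess.
  · refine Set.Subset.trans ?_ (hA.btr_sepConj_subset (monotone_monotonize R))
    rw [← monotonize_sepConj]
    exact Translation.btr_mono (monotonize_mono hsub)
  · rw [sepConj_comm B, monotonize_sepConj]
    exact (sepConj_mono subset_rfl hB).trans (Translation.sepConj_btr_subset hheap _ _)

/-- The rule for a statement whose translation `inhale A; C; exhale B` verifies. -/
theorem btr_subset_of_inhale_exhale {A B : L.Assertion} {C : L.Stmt}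
    {c : F.Stmt} (hA : Monotone (A (T.ctx Δ))) (hB : Monotone (B (T.ctx Δ)))
    (ih : ∀ P Q, L.AxSem (T.ctx Δ) P C Q →
      F.CSL Δ (T.btr (monotonize P)) c (T.btr (monotonize Q)))
    (h : ∃ Q, L.AxSem (T.ctx Δ) Set.univ (.seq (.inhale A) (.seq C (.exhale B))) Q) :
    ∃ R, F.CSL Δ (T.btr (A (T.ctx Δ))) c R ∧ R ⊆ T.btr (B (T.ctx Δ)) := by
  obtain ⟨Q, h⟩ := h
  obtain ⟨R, hR, hsub⟩ := h.inhale_exhale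
  rw [sepConj_univ_left hA] at hR
  have hc := ih _ _ hR
  rw [hA.monotonize_eq] at hc
  refine ⟨_, hc, Translation.btr_mono ?_⟩
  rw [← hB.monotonize_eq]
  exact monotonize_mono (hsub.trans (sepConj_subset_right _ hB))

/-- The translation of a loop is sound: the invariant of the loop is the loop assertion
restricted to the states in which the condition is defined. -/
theorem CSL.of_main_while (hF : F.Requirements) (hty : T.TypeRequirements)
    (hheap : T.HeapRequirements) (htr : T.TranslationRequirements) {b : F.BE} {I : F.Assertion}
    {c : F.Stmt} (hI : SelfFraming (I.interp Δ))
    (hst : StableUnder (F.evalBE b Δ) (I.interp Δ))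
    (ih : ∀ P Q, L.AxSem (T.ctx Δ) P (T.main c) Q →
      F.CSL Δ (T.btr (monotonize P)) c (T.btr (monotonize Q)))
    (haux : ∃ R : Set (State (T.ctx Δ)), L.AxSem (T.ctx Δ) Set.univ
      (.seq (.inhale (.star (T.asrt I) (T.asrt (.bool b))))
        (.seq (T.main c) (.exhale (T.loopInv b I)))) R)
    {P Q : Set (State (T.ctx Δ))} (h : L.AxSem (T.ctx Δ) P (T.main (.while b I c)) Q) :
    F.CSL Δ (T.btr (monotonize P)) (.while b I c) (T.btr (monotonize Q)) := by
  have hfaith := Translation.faithful hF hty hheap htr I Δ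
  have hbtr : ∀ a, T.btr (sepConj (T.asrt I (T.ctx Δ)) (exprSet (T.be b (T.ctx Δ)) a)) =
      I.interp Δ ∩ exprSet (F.evalBE b Δ) a := fun a => by
    rw [Translation.btr_sepConj_exprSet hF htr hheap hfaith.monotone, hfaith.btr_eq]
  set J := I.interp Δ ∩ exprSet (F.evalBE b Δ) true ∪ I.interp Δ ∩ exprSet (F.evalBE b Δ) false
    with hJ
  have hJI : J ⊆ I.interp Δ := Set.union_subset Set.inter_subset_left Set.inter_subset_left
  have hJb : ∀ a, J ∩ exprSet (F.evalBE b Δ) a = I.interp Δ ∩ exprSet (F.evalBE b Δ) a := by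
    intro a
    refine Set.Subset.antisymm (Set.inter_subset_inter_left _ hJI) fun ω hω => ⟨?_, hω.2⟩
    cases a with
    | true => exact Or.inl hω
    | false => exact Or.inr hω
  have hsf : ∀ a, SelfFraming (I.interp Δ ∩ exprSet (F.evalBE b Δ) a) := hI.inter_exprSet hst
  have hJsf : SelfFraming J := (hsf true).union (hsf false)
  have hinv : T.btr (T.loopInv b I (T.ctx Δ)) = J := by
    rw [Translation.loopInv_eq, hJ, ← hbtr, ← hbtr]
    rfl
  have hsplits : T.Splits J (T.loopInv b I (T.ctx Δ)) := by
    rw [Translation.loopInv_eq]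
    -- For each value `a`, monotonicity puts the starred assertion inside both of its factors, so
    -- the invariant can be split off with `b` evaluated.
    have := fun a => (hfaith.splits.mono subset_rfl fun Ω hΩ => ?_).inter_exprSet hF hheap htr
      (hfaith.monotone_interp hheap) b a
      (sepConj_subset_right (T.asrt I (T.ctx Δ)) ((htr.be_monotone b Δ).monotone_exprSet a))
    · exact (this true).union (this false)
    · exact hfaith.monotone _ hΩ.choose_spec.1 _ (geq_left hΩ.choose_spec.2.choose_spec.2)
  obtain ⟨R, hR, hsub⟩ := btr_subset_of_inhale_exhale (hfaith.monotone.sepConj_left _)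
    (hfaith.monotone.sepConj_left _) ih haux
  have hpre : T.btr (IVL.Assertion.star (T.asrt I) (T.asrt (.bool b)) (T.ctx Δ)) =
    J ∩ exprSet (F.evalBE b Δ) true := (hbtr true).trans (hJb true).symm
  rw [hpre] at hR
  rw [hinv] at hsub
  have hloop : F.CSL Δ J (.while b I c) (J ∩ exprSet (F.evalBE b Δ) false) := by
    refine .while ?_ (fun ω hω => hst ω (hJI hω))
      (hR.conseq subset_rfl hsub ((hJb true).symm ▸ hsf true) hJsf)
    rintro ω (hω | hω)
    all_goals exact Option.isSome_iff_exists.2 ⟨_, hω.2⟩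
  refine CSL.of_exhale_havocs_inhale hheap hloop hsplits ?_ (hfaith.monotone.sepConj_left _) h
  rw [hJb, ← hbtr, ← Translation.ofExpr_not]
  rfl

/-- The conditions are arbitrary so that sequencing can use the intermediate condition of the IVL
derivation; since both ends are closed in the same way, the two triples compose. -/
theorem CSL.of_main (hF : F.Requirements) (hty : T.TypeRequirements)
    (hheap : T.HeapRequirements) (htr : T.TranslationRequirements) (c : F.Stmt) :
    c.WF Δ → (∀ C ∈ T.aux c, ∃ R : Set (State (T.ctx Δ)), L.AxSem (T.ctx Δ) Set.univ C R) →
      ∀ P Q, L.AxSem (T.ctx Δ) P (T.main c) Q →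
        F.CSL Δ (T.btr (monotonize P)) c (T.btr (monotonize Q)) := by
  have hfaith := fun A => Translation.faithful hF hty hheap htr A Δ
  induction c with
  | skip =>
    intro _ _ P Q h
    cases h with
    | skip hP => exact .skip (Translation.selfFraming_btr hheap hP.monotonize)
  | prim c =>
    intro hc _ P Q h
    exact htr.prim_preserved Δ c hc _ _ (monotone_monotonize P) (monotone_monotonize Q)
      (htr.prim_affine Δ c hc P Q h)
  | seq c₁ c₂ ih₁ ih₂ =>
    intro hc haux P Q h
    cases h with
    | seq h₁ h₂ =>
      exact .seq (ih₁ hc.1 (fun C hC => haux C (Or.inl hC)) _ _ h₁)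
        (ih₂ hc.2 (fun C hC => haux C (Or.inr hC)) _ _ h₂)
  | ite b c₁ c₂ ih₁ ih₂ =>
    intro hc haux P Q h
    cases h with
    | ite hP hb h₁ h₂ =>
      have k₁ := ih₁ hc.1 (fun C hC => haux C (Or.inl hC)) _ _ h₁
      have k₂ := ih₂ hc.2 (fun C hC => haux C (Or.inr hC)) _ _ h₂
      -- The star with the condition in the IVL rule becomes the intersection of the front-end rule,
      -- because the condition is pure.
      rw [monotonize_sepConj, Translation.btr_sepConj_exprSet hF htr hheap
        (monotone_monotonize P)] at k₁ k₂
      rw [monotonize_union]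
      refine .ite ?_ k₁ k₂
      rintro ω ⟨Ω₀, h₀, hg⟩
      obtain ⟨a, ha⟩ := Option.isSome_iff_exists.1 (hb Ω₀ h₀)
      rw [htr.be_preserved, htr.be_monotone b Δ _ _ a ha hg]
      rfl
  | par P₁ c₁ Q₁ P₂ c₂ Q₂ ih₁ ih₂ =>
    intro hc haux P Q h
    obtain ⟨hc₁, hc₂, hP₁, hQ₁, hP₂, hQ₂, hw₁, hw₂⟩ := hc
    have branch : ∀ {A B : F.Assertion} {c : F.Stmt}, SelfFraming (A.interp Δ) →
        SelfFraming (B.interp Δ) → (∀ P Q, L.AxSem (T.ctx Δ) P (T.main c) Q →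
          F.CSL Δ (T.btr (monotonize P)) c (T.btr (monotonize Q))) →
        (∃ R : Set (State (T.ctx Δ)), L.AxSem (T.ctx Δ) Set.univ
          (.seq (.inhale (T.asrt A)) (.seq (T.main c) (.exhale (T.asrt B)))) R) →
        F.CSL Δ (A.interp Δ) c (B.interp Δ) := by
      intro A B c hA hB ih h
      obtain ⟨R, hR, hsub⟩ := btr_subset_of_inhale_exhale (hfaith A).monotone
        (hfaith B).monotone ih h
      rw [(hfaith _).btr_eq] at hR hsub
      exact hR.conseq subset_rfl hsub hA hB
    have k₁ := branch hP₁ hQ₁ (ih₁ hc₁ fun C hC => haux C (Or.inl (Or.inr hC)))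
      (haux _ (Or.inl (Or.inl (Or.inl rfl))))
    have k₂ := branch hP₂ hQ₂ (ih₂ hc₂ fun C hC => haux C (Or.inr hC))
      (haux _ (Or.inl (Or.inl (Or.inr rfl))))
    have indep : ∀ {A : F.Assertion} {x : Var}, x ∉ A.fv → IndependentOf (A.interp Δ) x :=
      fun hx => Assertion.independentOf_interp hF _ Δ _ hx
    simp only [← Finset.disjoint_iff_inter_eq_empty, Finset.disjoint_union_right] at hw₁ hw₂
    obtain ⟨⟨hf₁, hp₁⟩, hq₁⟩ := hw₁
    obtain ⟨⟨hf₂, hp₂⟩, hq₂⟩ := hw₂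
    refine CSL.of_exhale_havocs_inhale hheap (.par k₁ k₂
      (Finset.disjoint_iff_inter_eq_empty.1 hf₂.symm)
      (Finset.disjoint_iff_inter_eq_empty.1 hf₁.symm)
      (fun x hx => ⟨indep (Finset.disjoint_left.1 hp₁ hx), indep (Finset.disjoint_left.1 hq₁ hx)⟩)
      (fun x hx => ⟨indep (Finset.disjoint_left.1 hp₂ hx), indep (Finset.disjoint_left.1 hq₂ hx)⟩))
      (hfaith (.star P₁ P₂)).splits (hfaith (.star Q₁ Q₂)).btr_eq.ge
      (hfaith (.star Q₁ Q₂)).monotone h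
  | _ =>
    rename_i b I c ih
    -- The only remaining constructor is the loop.
    intro hc haux P Q h
    exact CSL.of_main_while hF hty hheap htr hc.2.1 hc.2.2
      (ih hc.1 fun C hC => haux C (Or.inr hC)) (haux _ (Or.inl rfl)) h

end FrontEnd

end TransVerif

theorem theorem3p7 {Var : Type w} [DecidableEq Var]
    (F : TransVerif.FrontEnd.{u} Var) (L : TransVerif.IVL.{v} Var)
    (T : TransVerif.Translation F L)
    (hF : F.Requirements) (hty : T.TypeRequirements)
    (hheap : T.HeapRequirements) (htr : T.TranslationRequirements)
    (Δ : TransVerif.Ctx Var F.model) (c : F.Stmt) (hc : c.WF Δ)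
    (C_m : L.Stmt) (C_e : Set L.Stmt) (htrc : T.stmt c = (C_m, C_e))
    (P Q : F.Assertion)
    (hmain : L.AxSem (T.ctx Δ) (T.asrt P (T.ctx Δ)) C_m (T.asrt Q (T.ctx Δ)))
    (haux : ∀ C ∈ C_e, ∃ Q_C : Set (TransVerif.State (T.ctx Δ)),
      L.AxSem (T.ctx Δ) Set.univ C Q_C) :
    F.CSL Δ (P.interp Δ) c (Q.interp Δ) := by
  obtain ⟨rfl, rfl⟩ := Prod.mk.inj htrc
  have hP := TransVerif.Translation.faithful hF hty hheap htr P Δ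
  have hQ := TransVerif.Translation.faithful hF hty hheap htr Q Δ
  have h := TransVerif.FrontEnd.CSL.of_main hF hty hheap htr c hc haux _ _ hmain
  rwa [hP.monotone.monotonize_eq, hQ.monotone.monotonize_eq, hP.btr_eq, hQ.btr_eq] at h
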